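/- Let $R$ be a unital $*$-regular ring, i.e. a ring with $1$ and with an involution $*$ (an anti-automorphism of order two) such that every $x\in R$ satisfies $xyx=x$ for some $y\in R$, and $xx^*=0$ implies $x=0$. Let $L=\overline L(R_R)$ be the lattice of principal right ideals of $R$. It is a modular ortholattice with $I^\perp=\{x\in R: y^*x=0 \text{ for all } y\in I\}$. Write $+$ and $\cdot$ for join and meet, and let $k\ge 0$, $N=3+k$. Let $\Phi$ be a stable orthogonal frame of format $(3,k)$ in $L$. That is, $\Phi$ consists of elements $a_i$ $(0\le i<N)$, $a_{ij}$ $(0\le i<3,\ 0\le j<N,\ i\neq j)$ and $z_{ij}$ $(0\le j<3\le i<N)$ of $L$ such that: * the $a_i$ are independent with join $1_L$, and $a_i^\perp=\sum_{j\ne i}a_j$ for all $i$; * for $i=1,2$: $a_0\cdot a_{0i}=a_i\cdot a_{0i}=0$ and $a_0+a_{0i}=a_i+a_{0i}=a_0+a_i$; * for $3\le i<N$, with $d_i=a_0\cdot(a_i+a_{0i})$: $a_i\cdot a_{0i}=d_i\cdot a_{0i}=0$ and $d_i+a_i=a_i+a_{0i}=d_i+a_{0i}$; * $a_{i0}=a_{0i}$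 for $i=1,2$, and $a_{ij}=(a_{0i}+a_{0j})\cdot(a_i+a_j)$ for $i\in\{1,2\}$, $1\le j<N$, $i\ne j$; * $z_{ij}=a_j\cdot b_{ji}^\perp$ is the relative orthocomplement of $b_{ji}=a_j\cdot(a_i+a_{ji})$ in $[0,a_j]$. Let $D$ be a skew field with involution, $V_D$ a right vector space with a hermitian form $\langle\cdot,\cdot\rangle$ (biadditive, $\langle vc,wd\rangle=c^*\langle v,w\rangle d$, $\langle v,w\rangle^*=\langle w,v\rangle$; for instance a scalar product, i.e. an anisotropic such form), and let $\iota:L\hookrightarrow L(V_D,\langle\cdot,\cdot\rangle)$ be a faithful representation, i.e. an injective homomorphism of bounded lattices into the lattice of subspaces of $V_D$ with $\iota(x^\perp)=\iota(x)^\perp$ for all $x\in L$. The induced map $\rho:R\to\mathrm{End}(V_D)$ is defined as follows. For submodules $M_i,M_j$ with $M_i\cap M_j=0$, the graph of a morphism $f:M_i\to M_j$ is $\Gamma(f)=\{x-f(x):x\in M_i\}$. Put $M_i=a_i$, a submodule of $R_R$, with projections $\pi_i$ and inclusions $\epsilon_i$ belonging to $R_R=\bigoplus_{i<N} M_i$.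 Let $\epsilon_{ij}:M_j\to M_i$ be the identity for $i=j$, and the morphism with graph $a_{ij}$ for $i<3$, $i\ne j$. For $j<3\le i$, let $\epsilon_{ij}$ be the left inverse of $\epsilon_{ji}$ that vanishes on $z_{ij}$. Let $M'_i=\iota(a_i)$, $\pi'_i$, $\epsilon'_i$, $\epsilon'_{ij}$ be obtained in the same way in $V_D$ from the frame $\iota[\Phi]$. For $\varphi\in\mathrm{End}(M_0)$ with $\Gamma(\epsilon_{10}\varphi)\in L$ put $\eta(\varphi)=\epsilon'_{01}\psi$, where $\psi:M_0'\to M_1'$ is the morphism with graph $\iota(\Gamma(\epsilon_{10}\varphi))$. Finally, with $\widehat r$ the left multiplication by $r$ on $R_R$, $$\rho(r)=\sum_{i,j<N}\epsilon'_j\,\epsilon'_{j0}\,\eta\big(\epsilon_{0j}\,(\pi_j\,\widehat r\,\epsilon_i)\,\epsilon_{i0}\big)\,\epsilon'_{0i}\,\pi'_i .$$ Then $\rho:R\to\mathrm{End}(V_D)$ is an embedding of involutive unital rings: it is an injective homomorphism of unital rings and, for every $r\in R$, $\rho(r^*)$ is the adjoint of $\rho(r)$, i.e. the unique $g\in\mathrm{End}(V_D)$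 with $\langle\rho(r)v,w\rangle=\langle v,g w\rangle$ for all $v,w\in V$. -/

import Mathlib

/-! ### Modular ortholattices -/

/-- A modular ortholattice (MOL): a bounded modular lattice with an orthocomplementation. -/
class IsModularOrtholattice (L : Type*) [Lattice L] [BoundedOrder L] [Compl L] : Prop
    extends IsModularLattice L where
  compl_compl' : ∀ x : L, xᶜᶜ = x
  compl_antitone' : ∀ x y : L, x ≤ y → yᶜ ≤ xᶜ
  isCompl_compl' : ∀ x : L, IsCompl x xᶜ

/-! ### Frames

The index set of a frame of format `(n, k)` is `{i : ℕ | i < n + k}`; families are indexed by `ℕ`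
and only their values at the relevant indices matter. -/

/-- The entries of a frame: elements `a i`, axes `ax i j` (the `a_{ij}`, axis between `a j` and
`a i`) and relative complements `z i j`. -/
structure FrameData (L : Type*) where
  a : ℕ → L
  ax : ℕ → ℕ → L
  z : ℕ → ℕ → L

/-- The image of a frame under a map. -/
def FrameData.map {L L' : Type*} (Φ : FrameData L) (f : L → L') : FrameData L' where
  a i := f (Φ.a i)
  ax i j := f (Φ.ax i j)
  z i j := f (Φ.z i j)

/-- `{a i, ax 0 i : i < n + k}` is a large partial frame of format `(n, k)`. -/
structure FrameData.IsFrame {L : Type*} [Lattice L] [BoundedOrder L]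
    (n k : ℕ) (Φ : FrameData L) : Prop where
  /-- the `a i` are independent -/
  indep : (Finset.range (n + k)).SupIndep Φ.a
  /-- the `a i` span the lattice -/
  span : (Finset.range (n + k)).sup Φ.a = ⊤
  /-- `a i` is perspective to `a 0` for `0 < i < n`, with axis `ax 0 i` -/
  persp : ∀ i, 0 < i → i < n →
    Φ.a 0 ⊓ Φ.ax 0 i = ⊥ ∧ Φ.a 0 ⊔ Φ.ax 0 i = Φ.a 0 ⊔ Φ.a i ∧
    Φ.a i ⊓ Φ.ax 0 i = ⊥ ∧ Φ.a i ⊔ Φ.ax 0 i = Φ.a 0 ⊔ Φ.a i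
  /-- `a i` is subperspective to `a 0` for `n ≤ i < n + k`, with axis `ax 0 i` -/
  subpersp : ∀ i, n ≤ i → i < n + k →
    Φ.a i ⊓ Φ.ax 0 i = ⊥ ∧
    (Φ.a 0 ⊓ (Φ.a i ⊔ Φ.ax 0 i)) ⊔ Φ.a i = Φ.a i ⊔ Φ.ax 0 i ∧
    (Φ.a 0 ⊓ (Φ.a i ⊔ Φ.ax 0 i)) ⊓ Φ.ax 0 i = ⊥ ∧
    (Φ.a 0 ⊓ (Φ.a i ⊔ Φ.ax 0 i)) ⊔ Φ.ax 0 i = Φ.a i ⊔ Φ.ax 0 i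

/-- The image `b_{ji}` of `a i` under the (sub)perspectivity with axis `ax j i`, as a part
of `a j`. -/
def FrameData.image {L : Type*} [Lattice L] (Φ : FrameData L) (j i : ℕ) : L :=
  Φ.a j ⊓ (Φ.a i ⊔ Φ.ax j i)

/-- Stable frames of format `(n, k)`: all the axes `ax i j` (with `i < n`, `j < n + k`, `i ≠ j`)
are those generated by the axes `ax 0 i`, and the `z i j` are relative complements. -/
structure FrameData.IsStableFrame {L : Type*} [Lattice L] [BoundedOrder L]
    (n k : ℕ) (Φ : FrameData L) : Prop extends FrameData.IsFrame n k Φ where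
  ax_zero : ∀ i, 0 < i → i < n → Φ.ax i 0 = Φ.ax 0 i
  ax_eq : ∀ i j, 0 < i → i < n → 0 < j → j < n + k → i ≠ j →
    Φ.ax i j = (Φ.ax 0 i ⊔ Φ.ax 0 j) ⊓ (Φ.a i ⊔ Φ.a j)
  z_compl : ∀ i j, j < n → n ≤ i → i < n + k →
    Φ.image j i ⊓ Φ.z i j = ⊥ ∧ Φ.image j i ⊔ Φ.z i j = Φ.a j

/-- Stable orthogonal frames of format `(n, k)` in a modular ortholattice. -/
structure FrameData.IsStableOrthogonalFrame {L : Type*} [Lattice L] [BoundedOrder L] [Compl L]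
    (n k : ℕ) (Φ : FrameData L) : Prop extends FrameData.IsStableFrame n k Φ where
  orthogonal : ∀ i, i < n + k → (Φ.a i)ᶜ = ((Finset.range (n + k)).erase i).sup Φ.a
  z_orthogonal : ∀ i j, j < n → n ≤ i → i < n + k → Φ.z i j = Φ.a j ⊓ (Φ.image j i)ᶜ

/-! ### Graphs and the maps belonging to a frame of submodules -/

section Module

variable {S : Type*} [Ring S] {M : Type*} [AddCommGroup M] [Module S M]

/-- The graph `Γ(f) = {x - f x : x ∈ U}` of a morphism `f : U → W` between submodules. -/
def negGraph {U W : Submodule S M} (f : U →ₗ[S] W) : Submodule S M :=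
  LinearMap.range (U.subtype - W.subtype ∘ₗ f)

open Classical in
/-- The morphism `U → W` with graph `G`. It is unique if `U` and `W` have trivial intersection,
and it exists if moreover `G` is a complement of `W` in `[0, U + W]`. Otherwise the value may be
arbitrary. -/
noncomputable def ofNegGraph (U W G : Submodule S M) : U →ₗ[S] W :=
  if h : ∃ f : U →ₗ[S] W, negGraph f = G then h.choose else 0

open Classical in
/-- The left inverse `W → U` of an injective `f : U → W` that vanishes on a complement `Z` of
the image of `f` in `W`. -/
noncomputable def leftInverseVanishingOn {U W : Submodule S M} (f : U →ₗ[S] W)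
    (Z : Submodule S M) : W →ₗ[S] U :=
  if h : ∃ g : W →ₗ[S] U, g ∘ₗ f = LinearMap.id ∧ ∀ w : W, (w : M) ∈ Z → g w = 0
  then h.choose else 0

open Classical in
/-- The projection `π_i : M → a i` belonging to the decomposition `M = ⨁_{i < m} a i`. -/
noncomputable def frameProj (a : ℕ → Submodule S M) (m i : ℕ) : M →ₗ[S] a i :=
  if h : IsCompl (a i) (((Finset.range m).erase i).sup a) then
    Submodule.projectionOnto _ _ h else 0

/-- The morphism `ε_{ij} : a j → a i` belonging to a frame of format `(n, k)` of submodules.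
For `i < n`, `i ≠ j`, its graph is the axis `ax i j`; for `j < n ≤ i`, it is the left inverse
of `ε_{ji}` that vanishes on `z i j`. -/
noncomputable def FrameData.eps (n : ℕ) (Φ : FrameData (Submodule S M)) (i j : ℕ) :
    Φ.a j →ₗ[S] Φ.a i :=
  if h : i = j then Submodule.inclusion (le_of_eq (by rw [h]))
  else if i < n then ofNegGraph (Φ.a j) (Φ.a i) (Φ.ax i j)
  else if j < n then
    leftInverseVanishingOn (ofNegGraph (Φ.a i) (Φ.a j) (Φ.ax j i)) (Φ.z i j)
  else 0

/-- The component `φ_{ji} = π_j ∘ φ ∘ ε_i : a i → a j` of an endomorphism `φ` of `M` with respect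
to the decomposition `M = ⨁_{i < m} a i`. -/
noncomputable def frameComponent (a : ℕ → Submodule S M) (m : ℕ) (φ : Module.End S M) (j i : ℕ) :
    a i →ₗ[S] a j :=
  frameProj a m j ∘ₗ φ ∘ₗ (a i).subtype

/-- The coefficient ring `C(Φ, L, M)` (as a set): the endomorphisms `φ` of `a 0` such that the
graph of `ε_{10} ∘ φ` lies in the lattice `L` of submodules. -/
def coefficientRing (n : ℕ) (L : Sublattice (Submodule S M)) (Φ : FrameData L) :
    Set (Module.End S ((Φ.map ((↑) : L → Submodule S M)).a 0)) :=
  {φ | negGraph ((Φ.map ((↑) : L → Submodule S M)).eps n 1 0 ∘ₗ φ) ∈ L}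

section Transfer

variable {S' : Type*} [Ring S'] {M' : Type*} [AddCommGroup M'] [Module S' M']

open Classical in
/-- The map `η` on the coefficient ring induced by a map `ι` from `L` to the submodules of `M'`:
`η(φ) = ε'_{01} ∘ ψ`, where the graph of `ψ : a' 0 → a' 1` is the image under `ι` of the graph
of `ε_{10} ∘ φ`. Outside the coefficient ring the value is irrelevant. -/
noncomputable def etaCoefficient (n : ℕ) (L : Sublattice (Submodule S M)) (Φ : FrameData L)
    (ι : L → Submodule S' M') (φ : Module.End S ((Φ.map ((↑) : L → Submodule S M)).a 0)) :
    Module.End S' ((Φ.map ι).a 0) :=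
  if h : φ ∈ coefficientRing n L Φ then
    (Φ.map ι).eps n 0 1 ∘ₗ ofNegGraph ((Φ.map ι).a 0) ((Φ.map ι).a 1) (ι ⟨_, h⟩)
  else 0

/-- The map `η` on the matrix ring of the frame:
`η(φ) = ∑_{i,j} η(φ_{ji})` with `η(φ_{ji}) = ε'_{j0} ∘ η(ε_{0j} ∘ φ_{ji} ∘ ε_{i0}) ∘ ε'_{0i}`,
extended to all of `M'` by means of the projections and embeddings. -/
noncomputable def etaMatrix (n k : ℕ) (L : Sublattice (Submodule S M)) (Φ : FrameData L)
    (ι : L → Submodule S' M') (φ : Module.End S M) : Module.End S' M' :=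
  let Ψ : FrameData (Submodule S M) := Φ.map (↑)
  let Ψ' : FrameData (Submodule S' M') := Φ.map ι
  ∑ i ∈ Finset.range (n + k), ∑ j ∈ Finset.range (n + k),
    (Ψ'.a j).subtype ∘ₗ
      (Ψ'.eps n j 0 ∘ₗ
        etaCoefficient n L Φ ι
          (Ψ.eps n 0 j ∘ₗ frameComponent Ψ.a (n + k) φ j i ∘ₗ Ψ.eps n i 0) ∘ₗ
        Ψ'.eps n 0 i) ∘ₗ
      frameProj Ψ'.a (n + k) i

end Transfer

end Module

/-! ### `*`-regular rings and their lattices of principal right ideals -/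

/-- A unital ring with involution is `*`-regular if it is von Neumann regular and
`x x^* = 0` implies `x = 0`. -/
class IsStarRegularRing (R : Type*) [Ring R] [StarRing R] : Prop where
  regular : ∀ x : R, ∃ y : R, x * y * x = x
  proper : ∀ x : R, x * star x = 0 → x = 0

section StarRegular

variable {R : Type*} [Ring R] [StarRing R]

theorem mem_span_op_singleton {a x : R} :
    x ∈ Submodule.span Rᵐᵒᵖ ({a} : Set R) ↔ ∃ r, a * r = x := by
  rw [Submodule.mem_span_singleton]
  constructor
  · rintro ⟨r, rfl⟩
    exact ⟨r.unop, rfl⟩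
  · rintro ⟨r, rfl⟩
    exact ⟨MulOpposite.op r, rfl⟩

/-- The right ideal `{x : y^* x = 0 for all y ∈ I}`, which is orthogonal to `I` in the sense
that `a R ⊥ b R` if and only if `b^* a = 0`. -/
def rightIdealPerp (I : Submodule Rᵐᵒᵖ R) : Submodule Rᵐᵒᵖ R where
  carrier := {x | ∀ y ∈ I, star y * x = 0}
  add_mem' := by
    intro a b ha hb y hy
    rw [mul_add, ha y hy, hb y hy, add_zero]
  zero_mem' := by
    intro y _
    exact mul_zero _
  smul_mem' := by
    intro c x hx y hy
    rw [MulOpposite.smul_eq_mul_unop, ← mul_assoc, hx y hy, zero_mul]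

theorem mem_rightIdealPerp {I : Submodule Rᵐᵒᵖ R} {x : R} :
    x ∈ rightIdealPerp I ↔ ∀ y ∈ I, star y * x = 0 := Iff.rfl

theorem mul_mem_right_of_mem {I : Submodule Rᵐᵒᵖ R} {x : R} (h : x ∈ I) (r : R) : x * r ∈ I :=
  I.smul_mem (MulOpposite.op r) h

/-- `I` is generated by the projection `p`. -/
def IsProjectionOf (p : R) (I : Submodule Rᵐᵒᵖ R) : Prop :=
  star p = p ∧ p * p = p ∧ ∀ x, x ∈ I ↔ p * x = x

theorem IsProjectionOf.isPrincipal {p : R} {I : Submodule Rᵐᵒᵖ R} (h : IsProjectionOf p I) :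
    I.IsPrincipal := by
  refine ⟨⟨p, ?_⟩⟩
  ext x
  rw [mem_span_op_singleton, h.2.2]
  constructor
  · intro hx
    exact ⟨x, hx⟩
  · rintro ⟨r, rfl⟩
    rw [← mul_assoc, h.2.1]

theorem IsProjectionOf.perp {p : R} {I : Submodule Rᵐᵒᵖ R} (h : IsProjectionOf p I) :
    IsProjectionOf (1 - p) (rightIdealPerp I) := by
  obtain ⟨hs, hp, hI⟩ := h
  refine ⟨by simp [hs], ?_, ?_⟩
  · simp [mul_sub, sub_mul, hp]
  · intro x
    rw [mem_rightIdealPerp]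
    constructor
    · intro hx
      have := hx p ((hI p).2 hp)
      rw [hs] at this
      simp [sub_mul, this]
    · intro hx y hy
      have h1 : p * x = 0 := by
        have : x - p * x = x := by simpa [sub_mul] using hx
        simpa using this
      have h2 : star y = star y * p := by
        conv_lhs => rw [← (hI y).1 hy]
        rw [star_mul, hs]
      rw [h2, mul_assoc, h1, mul_zero]

theorem IsProjectionOf.perp_perp {p : R} {I : Submodule Rᵐᵒᵖ R} (h : IsProjectionOf p I) :
    rightIdealPerp (rightIdealPerp I) = I := by
  ext x
  rw [h.perp.perp.2.2, h.2.2]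
  simp

theorem rightIdealPerp_antitone {I J : Submodule Rᵐᵒᵖ R} (h : I ≤ J) :
    rightIdealPerp J ≤ rightIdealPerp I :=
  fun _ hx y hy => hx y (h hy)

theorem rightIdealPerp_sup (I J : Submodule Rᵐᵒᵖ R) :
    rightIdealPerp (I ⊔ J) = rightIdealPerp I ⊓ rightIdealPerp J := by
  apply le_antisymm
  · exact le_inf (rightIdealPerp_antitone le_sup_left) (rightIdealPerp_antitone le_sup_right)
  · rintro x ⟨h1, h2⟩ y hy
    obtain ⟨a, ha, b, hb, rfl⟩ := Submodule.mem_sup.1 hy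
    rw [star_add, add_mul, h1 a ha, h2 b hb, add_zero]

theorem IsProjectionOf.isCompl {p : R} {I : Submodule Rᵐᵒᵖ R} (h : IsProjectionOf p I) :
    IsCompl I (rightIdealPerp I) := by
  have h' := h.perp.2.2
  constructor
  · rw [disjoint_iff, eq_bot_iff]
    rintro x ⟨h1, h2⟩
    have e1 := (h.2.2 x).1 h1
    have e2 := (h' x).1 h2
    rw [sub_mul, one_mul, e1, sub_self] at e2
    exact e2.symm
  · rw [codisjoint_iff, eq_top_iff]
    intro x _
    refine Submodule.mem_sup.2 ⟨p * x, ?_, (1 - p) * x, ?_, ?_⟩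
    · rw [h.2.2, ← mul_assoc, h.2.1]
    · rw [h', ← mul_assoc, h.perp.2.1]
    · rw [sub_mul, one_mul, add_sub_cancel]

variable [IsStarRegularRing R]

theorem exists_isProjectionOf {I : Submodule Rᵐᵒᵖ R} (hI : I.IsPrincipal) :
    ∃ p, IsProjectionOf p I := by
  obtain ⟨⟨x, rfl⟩⟩ := hI
  obtain ⟨y, hy⟩ := IsStarRegularRing.regular (star x * x)
  have hx : x * y * star x * x = x := by
    have h0 : star (x * y * star x * x - x) = 0 := by
      apply IsStarRegularRing.proper
      rw [star_star]
      have h1 : star x * (x * y * star x * x - x) = 0 := by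
        rw [mul_sub, sub_eq_zero]
        simpa only [mul_assoc] using hy
      have h2 : star (x * y * star x * x - x) =
          (star (y * star x * x) - 1) * star x := by
        rw [sub_mul, one_mul, ← star_mul, star_sub]
        simp only [mul_assoc]
      rw [h2, mul_assoc, h1, mul_zero]
    exact sub_eq_zero.1 (star_eq_zero.1 h0)
  have hpp : x * y * star x * (x * y * star x) = x * y * star x := by
    rw [← mul_assoc, ← mul_assoc, hx]
  have hps : x * y * star x = x * y * star x * star (x * y * star x) := by
    have : star x = star x * star (x * y * star x) := by
      rw [← star_mul, hx]
    conv_lhs => rw [this]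
    simp only [mul_assoc]
  refine ⟨x * y * star x, ?_, hpp, ?_⟩
  · rw [hps, star_mul, star_star]
  · intro w
    rw [mem_span_op_singleton]
    constructor
    · rintro ⟨r, rfl⟩
      rw [← mul_assoc, hx]
    · intro hw
      exact ⟨y * star x * w, by rw [← hw]; simp only [← mul_assoc, hx]⟩

theorem isPrincipal_rightIdealPerp {I : Submodule Rᵐᵒᵖ R} (hI : I.IsPrincipal) :
    (rightIdealPerp I).IsPrincipal := by
  obtain ⟨p, hp⟩ := exists_isProjectionOf hI
  exact hp.perp.isPrincipal

theorem isPrincipal_sup_rightIdeal {I J : Submodule Rᵐᵒᵖ R} (hI : I.IsPrincipal)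
    (hJ : J.IsPrincipal) : (I ⊔ J).IsPrincipal := by
  obtain ⟨e, he⟩ := exists_isProjectionOf hI
  obtain ⟨⟨b, rfl⟩⟩ := hJ
  obtain ⟨f, hf⟩ := exists_isProjectionOf (I := Submodule.span Rᵐᵒᵖ {(1 - e) * b}) ⟨⟨_, rfl⟩⟩
  obtain ⟨t, ht⟩ := mem_span_op_singleton.1 ((hf.2.2 f).2 hf.2.1)
  have hef : e * f = 0 := by
    rw [← ht, ← mul_assoc, ← mul_assoc, mul_sub, mul_one, he.2.1, sub_self, zero_mul, zero_mul]
  have hfe : f * e = 0 := by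
    have := congrArg star hef
    rwa [star_mul, he.1, hf.1, star_zero] at this
  have hfb : f * ((1 - e) * b) = (1 - e) * b :=
    (hf.2.2 _).1 (Submodule.mem_span_singleton_self _)
  have hfb' : f * b = b - e * b := by
    have : f * ((1 - e) * b) = f * b := by
      rw [← mul_assoc, mul_sub, mul_one, hfe, sub_zero]
    rw [← this, hfb, sub_mul, one_mul]
  refine ⟨⟨e + f, ?_⟩⟩
  apply le_antisymm
  · apply sup_le
    · intro x hx
      have hx' := (he.2.2 x).1 hx
      refine mem_span_op_singleton.2 ⟨x, ?_⟩
      rw [add_mul, hx', ← hx', ← mul_assoc, hfe, zero_mul, add_zero]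
    · rw [Submodule.span_singleton_le_iff_mem]
      refine mem_span_op_singleton.2 ⟨b, ?_⟩
      rw [add_mul, hfb', add_sub_cancel]
  · rw [Submodule.span_singleton_le_iff_mem]
    have heI : e ∈ I := (he.2.2 e).2 he.2.1
    have key : e + f = e * (1 - b * t) + b * t := by
      rw [← ht]
      noncomm_ring
    rw [key]
    exact Submodule.add_mem_sup (mul_mem_right_of_mem heI _)
      (mem_span_op_singleton.2 ⟨t, rfl⟩)

theorem isPrincipal_inf_rightIdeal {I J : Submodule Rᵐᵒᵖ R} (hI : I.IsPrincipal)
    (hJ : J.IsPrincipal) : (I ⊓ J).IsPrincipal := by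
  obtain ⟨p, hp⟩ := exists_isProjectionOf hI
  obtain ⟨q, hq⟩ := exists_isProjectionOf hJ
  have h := isPrincipal_rightIdealPerp (isPrincipal_sup_rightIdeal
    (isPrincipal_rightIdealPerp hI) (isPrincipal_rightIdealPerp hJ))
  rwa [rightIdealPerp_sup, hp.perp_perp, hq.perp_perp] at h

variable (R) in
/-- The lattice `L(R_R)` of principal right ideals of a `*`-regular ring, a sublattice of the
lattice of all right ideals. -/
def principalRightIdeals : Sublattice (Submodule Rᵐᵒᵖ R) where
  carrier := {I | I.IsPrincipal}
  supClosed' := fun _ hI _ hJ => isPrincipal_sup_rightIdeal hI hJ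
  infClosed' := fun _ hI _ hJ => isPrincipal_inf_rightIdeal hI hJ

instance : BoundedOrder (principalRightIdeals R) where
  top := ⟨⊤, ⟨⟨1, by
    symm
    rw [eq_top_iff]
    intro x _
    exact mem_span_op_singleton.2 ⟨x, one_mul x⟩⟩⟩⟩
  le_top := fun I => (le_top : (I : Submodule Rᵐᵒᵖ R) ≤ ⊤)
  bot := ⟨⊥, ⟨⟨0, by simp⟩⟩⟩
  bot_le := fun I => (bot_le : ⊥ ≤ (I : Submodule Rᵐᵒᵖ R))

/-- The orthocomplementation of `L(R_R)`. -/
instance : Compl (principalRightIdeals R) where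
  compl I := ⟨rightIdealPerp I, isPrincipal_rightIdealPerp I.2⟩

instance : IsModularOrtholattice (principalRightIdeals R) where
  sup_inf_le_assoc_of_le := by
    intro x y z h
    exact IsModularLattice.sup_inf_le_assoc_of_le (y : Submodule Rᵐᵒᵖ R) h
  compl_compl' := by
    intro x
    obtain ⟨p, hp⟩ := exists_isProjectionOf x.2
    exact Subtype.ext hp.perp_perp
  compl_antitone' := fun _ _ h => rightIdealPerp_antitone h
  isCompl_compl' := by
    intro x
    obtain ⟨p, hp⟩ := exists_isProjectionOf x.2
    constructor
    · rw [disjoint_iff]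
      exact Subtype.ext (disjoint_iff.1 hp.isCompl.1)
    · rw [codisjoint_iff]
      exact Subtype.ext (codisjoint_iff.1 hp.isCompl.2)

end StarRegular

/-! ### Spaces with a hermitian form, and representations -/

/-- A hermitian form on a right vector space `V` over a skew field `D` with involution. -/
structure HermitianForm (D : Type*) [DivisionRing D] [StarRing D]
    (V : Type*) [AddCommGroup V] [Module Dᵐᵒᵖ V] where
  form : V → V → D
  add_left : ∀ u v w, form (u + v) w = form u w + form v w
  add_right : ∀ u v w, form u (v + w) = form u v + form u w
  smul_left : ∀ (d : D) v w, form (MulOpposite.op d • v) w = star d * form v w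
  smul_right : ∀ (d : D) v w, form v (MulOpposite.op d • w) = form v w * d
  hermitian : ∀ v w, star (form v w) = form w v

section Form

variable {D : Type*} [DivisionRing D] [StarRing D] {V : Type*} [AddCommGroup V] [Module Dᵐᵒᵖ V]

/-- The orthogonal subspace `W^⊥`. -/
def HermitianForm.perp (B : HermitianForm D V) (W : Submodule Dᵐᵒᵖ V) : Submodule Dᵐᵒᵖ V where
  carrier := {v | ∀ w ∈ W, B.form w v = 0}
  add_mem' := by
    intro a b ha hb w hw
    rw [B.add_right, ha w hw, hb w hw, add_zero]
  zero_mem' := by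
    intro w _
    have h := B.smul_right 0 w 0
    rwa [smul_zero, mul_zero] at h
  smul_mem' := by
    intro c v hv w hw
    have h := B.smul_right c.unop w v
    rwa [hv w hw, zero_mul, MulOpposite.op_unop] at h

/-- `f` and `g` are adjoint to each other. -/
def HermitianForm.IsAdjoint (B : HermitianForm D V) (f g : Module.End Dᵐᵒᵖ V) : Prop :=
  ∀ v w, B.form (f v) w = B.form v (g w)

/-- A representation of a modular ortholattice `L` in `V`: a homomorphism of bounded lattices
into the subspace lattice which turns the orthocomplementation into that of the form. -/
structure MOLRepresentation (L : Type*) [Lattice L] [BoundedOrder L] [Compl L]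
    (B : HermitianForm D V) extends BoundedLatticeHom L (Submodule Dᵐᵒᵖ V) where
  map_compl' : ∀ x, toFun xᶜ = B.perp (toFun x)

/-- The map `ρ = η ∘ θ : R → End(V_D)` induced by a frame `Φ` of format `(n, k)` in `L(R_R)` and a
representation `ι` of `L(R_R)`, where `θ r` is the left multiplication by `r`. -/
noncomputable def inducedRho {R : Type*} [Ring R] [StarRing R] [IsStarRegularRing R]
    {B : HermitianForm D V} (n k : ℕ) (Φ : FrameData (principalRightIdeals R))
    (ι : MOLRepresentation (principalRightIdeals R) B) (r : R) : Module.End Dᵐᵒᵖ V :=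
  etaMatrix n k (principalRightIdeals R) Φ ι.toFun (Module.toModuleEnd Rᵐᵒᵖ (S := R) R r)

end Form

/-! ### Graphs of morphisms between submodules -/

section Graph

variable {S : Type*} [Ring S] {M : Type*} [AddCommGroup M] [Module S M]

/-! A morphism between independent submodules is determined by its graph, and operations on
morphisms are lattice operations on graphs. For independent `A`, `B`, `C` the graph of a composite
`A → B → C` (`negGraph_comp`) and that of `f + g ∘ e`, with `f : A → B` and `g ∘ e : A → C → B`
(`negGraph_add_comp`), are lattice terms in the given graphs and submodules. A bounded lattice
homomorphism `ι` therefore carries morphisms between distinct frame components to morphisms in `V`,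
compatibly with these operations. The maps `ε_{0j}` and `ε_{j0}` go to their counterparts, because
their graphs are `a_{0j}` or `a_{0j} + z_{j0}`.

Endomorphisms of `a_0` have no such graph. They are moved to `a_0 → a_1`, and the third component
`a_2` gives the room needed to factor products and sums through distinct indices. So `η` is an
injective ring homomorphism on `End(a_0)`. It sends the idempotent `ε_{0j} ε_{j0}` to its
counterpart, so its extension `cell` to all components `a_i → a_j` respects composition, sums and
identities. Matrix calculus then gives multiplicativity and injectivity of `ρ`.

For adjoints, `cell` is shown to agree with the direct transport of graphs whenever `i ≠ j`
(`cell_eq_transfer`). If `I ⊥ J` and `g : J → I` is the adjoint of `f : I → J`, then `(x - f x)^* (y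
+ g y) = 0`: the graphs of `f` and `-g` are orthogonal, a relation that `ι` preserves
(`form_graphMap`). Diagonal components factor through another index (`form_cell`), and orthogonality
of the frame assembles the components. -/

theorem mem_negGraph {U W : Submodule S M} {f : U →ₗ[S] W} {m : M} :
    m ∈ negGraph f ↔ ∃ x : U, (x : M) - f x = m := by
  simp [negGraph]

theorem sub_mem_negGraph {U W : Submodule S M} (f : U →ₗ[S] W) (x : U) :
    (x : M) - f x ∈ negGraph f := mem_negGraph.2 ⟨x, rfl⟩

theorem sub_mem_negGraph_iff {U W : Submodule S M} (h : Disjoint U W) {f : U →ₗ[S] W}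
    {x : U} {y : W} : (x : M) - y ∈ negGraph f ↔ f x = y := by
  constructor
  · intro hm
    obtain ⟨u, hu⟩ := mem_negGraph.1 hm
    have e : (u : M) - x = f u - y := by
      rw [sub_eq_sub_iff_add_eq_add] at hu ⊢
      rw [hu, add_comm]
    have h0 : (u : M) - x = 0 :=
      Submodule.disjoint_def.1 h _ (U.sub_mem u.2 x.2) (e ▸ W.sub_mem (f u).2 y.2)
    have hux : u = x := Subtype.ext (sub_eq_zero.1 h0)
    rw [h0] at e
    subst hux
    exact Subtype.ext (sub_eq_zero.1 e.symm)
  · rintro rfl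
    exact sub_mem_negGraph f x

theorem negGraph_injective {U W : Submodule S M} (h : Disjoint U W) {f g : U →ₗ[S] W}
    (hfg : negGraph f = negGraph g) : f = g := by
  ext x : 1
  exact ((sub_mem_negGraph_iff h).1 (hfg ▸ sub_mem_negGraph f x)).symm

theorem ofNegGraph_eq {U W G : Submodule S M} (h : Disjoint U W) {f : U →ₗ[S] W}
    (hf : negGraph f = G) : ofNegGraph U W G = f := by
  have hex : ∃ f : U →ₗ[S] W, negGraph f = G := ⟨f, hf⟩
  rw [ofNegGraph, dif_pos hex]
  exact negGraph_injective h (hex.choose_spec.trans hf.symm)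

/-- Each `x ∈ U` splits as an element of `G` plus some `w ∈ W`; `G ∩ W = 0` makes `w` unique, and
uniqueness gives linearity of `x ↦ w`. -/
theorem exists_negGraph_eq {U W G : Submodule S M} (hG : Disjoint G W)
    (hs : G ⊔ W = U ⊔ W) : ∃ f : U →ₗ[S] W, negGraph f = G := by
  have key : ∀ x : U, ∃ y : W, (x : M) - y ∈ G := by
    intro x
    have hx : (x : M) ∈ G ⊔ W := hs ▸ Submodule.mem_sup_left x.2
    obtain ⟨g, hg, w, hw, e⟩ := Submodule.mem_sup.1 hx
    exact ⟨⟨w, hw⟩, by simpa [← e] using hg⟩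
  have uniq : ∀ (x : U) (y y' : W), (x : M) - y ∈ G → (x : M) - y' ∈ G → y = y' := by
    intro x y y' hy hy'
    have := G.sub_mem hy' hy
    rw [sub_sub_sub_cancel_left] at this
    exact Subtype.ext (sub_eq_zero.1
      (Submodule.disjoint_def.1 hG _ this (W.sub_mem y.2 y'.2)))
  choose F hF using key
  let f : U →ₗ[S] W :=
    { toFun := F
      map_add' := fun x y => uniq (x + y) _ _ (hF _) (by
        have := G.add_mem (hF x) (hF y)
        rwa [sub_add_sub_comm] at this)
      map_smul' := fun c x => uniq (c • x) _ _ (hF _) (by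
        have := G.smul_mem c (hF x)
        rwa [smul_sub] at this) }
  refine ⟨f, le_antisymm ?_ ?_⟩
  · intro m hm
    obtain ⟨x, rfl⟩ := mem_negGraph.1 hm
    exact hF x
  · intro m hm
    have hm' : m ∈ U ⊔ W := hs ▸ Submodule.mem_sup_left hm
    obtain ⟨u, hu, w, hw, rfl⟩ := Submodule.mem_sup.1 hm'
    refine mem_negGraph.2 ⟨⟨u, hu⟩, ?_⟩
    have : F ⟨u, hu⟩ = -⟨w, hw⟩ := uniq ⟨u, hu⟩ _ _ (hF _) (by simpa using hm)
    change u - (F ⟨u, hu⟩ : M) = _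
    rw [this]
    simp

theorem negGraph_ofNegGraph {U W G : Submodule S M} (h : Disjoint U W) (hG : Disjoint G W)
    (hs : G ⊔ W = U ⊔ W) : negGraph (ofNegGraph U W G) = G := by
  obtain ⟨f, hf⟩ := exists_negGraph_eq hG hs
  rw [ofNegGraph_eq h hf, hf]

theorem disjoint_negGraph {U W : Submodule S M} (h : Disjoint U W) (f : U →ₗ[S] W) :
    Disjoint (negGraph f) W := by
  rw [Submodule.disjoint_def]
  intro m hm hw
  have h0 : (((0 : U) : M)) - ((-⟨m, hw⟩ : W) : M) ∈ negGraph f := by simpa using hm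
  have := (sub_mem_negGraph_iff h).1 h0
  rw [map_zero] at this
  have := congrArg (Subtype.val) this
  simpa using this.symm

theorem negGraph_sup {U W : Submodule S M} (f : U →ₗ[S] W) : negGraph f ⊔ W = U ⊔ W := by
  apply le_antisymm
  · refine sup_le ?_ le_sup_right
    intro m hm
    obtain ⟨x, rfl⟩ := mem_negGraph.1 hm
    exact Submodule.sub_mem _ (Submodule.mem_sup_left x.2) (Submodule.mem_sup_right (f x).2)
  · refine sup_le ?_ le_sup_right
    intro x hx
    exact Submodule.mem_sup.2 ⟨_, sub_mem_negGraph f ⟨x, hx⟩, _, (f ⟨x, hx⟩).2, by simp⟩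

/-- The inclusion `≤` is `x - g (f x) = (x - f x) + (f x - g (f x))`. Conversely, if `(x - f x) + (y
- g y)` lies in `A + C`, then so does `y - f x ∈ B`, and independence forces `y = f x`. -/
theorem negGraph_comp {A B C : Submodule S M} (hB : Disjoint B (A ⊔ C))
    (f : A →ₗ[S] B) (g : B →ₗ[S] C) :
    negGraph (g ∘ₗ f) = (negGraph f ⊔ negGraph g) ⊓ (A ⊔ C) := by
  apply le_antisymm
  · intro m hm
    obtain ⟨x, rfl⟩ := mem_negGraph.1 hm
    refine ⟨Submodule.mem_sup.2 ⟨_, sub_mem_negGraph f x, _, sub_mem_negGraph g (f x), ?_⟩,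
      Submodule.sub_mem _ (Submodule.mem_sup_left x.2)
        (Submodule.mem_sup_right (g (f x)).2)⟩
    simp
  · rintro m ⟨hm, hAC⟩
    obtain ⟨m₁, h₁, m₂, h₂, rfl⟩ := Submodule.mem_sup.1 hm
    obtain ⟨x, rfl⟩ := mem_negGraph.1 h₁
    obtain ⟨y, rfl⟩ := mem_negGraph.1 h₂
    have h0 : (y : M) - f x ∈ A ⊔ C := by
      have e : (y : M) - f x = ((x : M) - f x + (y - g y)) - x + g y := by abel
      rw [e]
      exact Submodule.add_mem _ (Submodule.sub_mem _ hAC (Submodule.mem_sup_left x.2))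
        (Submodule.mem_sup_right (g y).2)
    have hy : y = f x := Subtype.ext (sub_eq_zero.1
      (Submodule.disjoint_def.1 hB _ (B.sub_mem y.2 (f x).2) h0))
    subst hy
    exact mem_negGraph.2 ⟨x, by simp⟩

/-- Von Neumann's addition. The inner meet consists of the elements `x - f x - e x`; adding `e x - g
(e x)` from the graph of `g` replaces `e x` by `g (e x)`. The second summand passes through `C` so
that `f` and `e` can be combined without interfering. -/
theorem negGraph_add_comp {A B C : Submodule S M} (hA : Disjoint A (B ⊔ C))
    (hBC : Disjoint B C) (hC : Disjoint C (A ⊔ B))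
    (f : A →ₗ[S] B) (e : A →ₗ[S] C) (g : C →ₗ[S] B) :
    negGraph (f + g ∘ₗ e) =
      (((negGraph f ⊔ C) ⊓ (negGraph e ⊔ B)) ⊔ negGraph g) ⊓ (A ⊔ B) := by
  apply le_antisymm
  · intro m hm
    obtain ⟨x, rfl⟩ := mem_negGraph.1 hm
    refine ⟨Submodule.mem_sup.2 ⟨(x : M) - f x - e x, ⟨?_, ?_⟩, _,
      sub_mem_negGraph g (e x), ?_⟩, ?_⟩
    · exact Submodule.sub_mem _ (Submodule.mem_sup_left (sub_mem_negGraph f x))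
        (Submodule.mem_sup_right (e x).2)
    · rw [sub_right_comm]
      exact Submodule.sub_mem _ (Submodule.mem_sup_left (sub_mem_negGraph e x))
        (Submodule.mem_sup_right (f x).2)
    · simp only [LinearMap.add_apply, LinearMap.comp_apply, Submodule.coe_add]
      abel
    · exact Submodule.sub_mem _ (Submodule.mem_sup_left x.2) (Submodule.mem_sup_right
        ((f + g ∘ₗ e) x).2)
  · rintro m ⟨hm, hAB⟩
    obtain ⟨m₁, ⟨h₁, h₁'⟩, m₂, h₂, rfl⟩ := Submodule.mem_sup.1 hm
    obtain ⟨_, hf, c, hc, rfl⟩ := Submodule.mem_sup.1 h₁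
    obtain ⟨_, he, b, hb, e₁⟩ := Submodule.mem_sup.1 h₁'
    obtain ⟨x, rfl⟩ := mem_negGraph.1 hf
    obtain ⟨x', rfl⟩ := mem_negGraph.1 he
    obtain ⟨z, rfl⟩ := mem_negGraph.1 h₂
    -- The two descriptions of one element of the meet are compared component by component, first in
    -- `A`, then in `C`.
    have hx : x' = x := by
      refine Subtype.ext (sub_eq_zero.1 (Submodule.disjoint_def.1 hA _
        (A.sub_mem x'.2 x.2) ?_))
      have : (x' : M) - x = (-(f x : M) - b) + (c + e x') := by
        rw [← sub_eq_zero, ← sub_eq_zero.2 e₁]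
        abel
      rw [this]
      exact Submodule.add_mem_sup (B.sub_mem (B.neg_mem (f x).2) hb)
        (C.add_mem hc (e x').2)
    subst hx
    have hce : c + e x' = 0 := by
      refine Submodule.disjoint_def.1 hBC _ ?_ (C.add_mem hc (e x').2)
      have : c + e x' = (f x' : M) + b := by
        rw [← sub_eq_zero, ← sub_eq_zero.2 e₁.symm]
        abel
      rw [this]
      exact B.add_mem (f x').2 hb
    -- In this shape, rewriting a zero backwards inserts exactly the relation that `abel` is
    -- missing.
    have hce' : 0 - (c + e x') = 0 := sub_eq_zero.2 hce.symm
    have hz : z = e x' := by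
      refine Subtype.ext (sub_eq_zero.1 (Submodule.disjoint_def.1 hC _
        (C.sub_mem z.2 (e x').2) ?_))
      have : (z : M) - e x' = ((x' : M) - f x' + c + (z - g z)) - x' + (f x' + g z) := by
        rw [← sub_eq_zero, ← hce']
        abel
      rw [this]
      exact Submodule.add_mem _ (Submodule.sub_mem _ hAB (Submodule.mem_sup_left x'.2))
        (Submodule.mem_sup_right (B.add_mem (f x').2 (g z).2))
    subst hz
    refine mem_negGraph.2 ⟨x', ?_⟩
    simp only [LinearMap.add_apply, LinearMap.comp_apply, Submodule.coe_add]
    rw [← sub_eq_zero, ← hce']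
    abel

/-- The negative of `x - f x` is `f x - x`, which puts `(f x, x)` in the graph of `g`. -/
theorem negGraph_inverse {U W : Submodule S M} {f : U →ₗ[S] W} {g : W →ₗ[S] U}
    (h : Disjoint U W) (hfg : negGraph f = negGraph g) : g ∘ₗ f = LinearMap.id := by
  ext x : 1
  refine (sub_mem_negGraph_iff h.symm).1 ?_
  rw [← hfg, ← neg_sub]
  exact Submodule.neg_mem _ (sub_mem_negGraph f x)

/-- This identifies the range of `ε_{0j}` with the lattice element `FrameData.image`, of which `z`
is a relative complement. -/
theorem mem_range_iff_of_disjoint {U W : Submodule S M} (h : Disjoint U W) {f : U →ₗ[S] W}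
    {w : W} : w ∈ LinearMap.range f ↔ (w : M) ∈ W ⊓ (U ⊔ negGraph f) := by
  constructor
  · rintro ⟨u, rfl⟩
    refine ⟨(f u).2, ?_⟩
    have : (f u : M) = u - (u - f u) := by abel
    rw [this]
    exact Submodule.sub_mem _ (Submodule.mem_sup_left u.2)
      (Submodule.mem_sup_right (sub_mem_negGraph f u))
  · rintro ⟨-, hw⟩
    obtain ⟨u, hu, m, hm, e⟩ := Submodule.mem_sup.1 hw
    obtain ⟨x, rfl⟩ := mem_negGraph.1 hm
    have h0 : (w : M) + f x = 0 := by
      refine Submodule.disjoint_def.1 h _ ?_ (W.add_mem w.2 (f x).2)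
      have : (w : M) + f x = u + x := by rw [← e]; abel
      rw [this]
      exact U.add_mem hu x.2
    refine ⟨-x, Subtype.ext ?_⟩
    rw [map_neg, Submodule.coe_neg]
    exact (eq_neg_of_add_eq_zero_left h0).symm

theorem exists_leftInverseVanishingOn {U W Z : Submodule S M} {f : U →ₗ[S] W}
    (hf : Function.Injective f) (hZ : IsCompl (LinearMap.range f) (Z.comap W.subtype)) :
    ∃ g : W →ₗ[S] U, g ∘ₗ f = LinearMap.id ∧ ∀ w : W, (w : M) ∈ Z → g w = 0 := by
  refine ⟨(LinearEquiv.ofInjective f hf).symm.toLinearMap ∘ₗ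
    Submodule.projectionOnto _ _ hZ, ?_, ?_⟩
  · ext x : 1
    have : Submodule.projectionOnto _ _ hZ (f x) = LinearEquiv.ofInjective f hf x :=
      Submodule.projectionOnto_apply_left hZ (LinearEquiv.ofInjective f hf x)
    simp [this]
  · intro w hw
    have : Submodule.projectionOnto _ _ hZ w = 0 :=
      (Submodule.projectionOnto_apply_eq_zero_iff hZ).2 hw
    simp [this]

theorem leftInverseVanishingOn_spec {U W Z : Submodule S M} {f : U →ₗ[S] W}
    (hf : Function.Injective f) (hZ : IsCompl (LinearMap.range f) (Z.comap W.subtype)) :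
    leftInverseVanishingOn f Z ∘ₗ f = LinearMap.id ∧
      ∀ w : W, (w : M) ∈ Z → leftInverseVanishingOn f Z w = 0 := by
  have h := exists_leftInverseVanishingOn hf hZ
  rw [leftInverseVanishingOn, dif_pos h]
  exact h.choose_spec

/-- On the range of `f` the graph of `g` is that of `f` up to sign, and on `Z` it is `Z` itself.
Hence `ε_{j0}` for `j ≥ n` also has a graph generated by frame entries. -/
theorem negGraph_of_leftInverse {U W Z : Submodule S M} (hZW : Z ≤ W) {f : U →ₗ[S] W}
    {g : W →ₗ[S] U} (hZ : LinearMap.range f ⊔ Z.comap W.subtype = ⊤)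
    (hg : g ∘ₗ f = LinearMap.id) (hgZ : ∀ w : W, (w : M) ∈ Z → g w = 0) :
    negGraph g = negGraph f ⊔ Z := by
  have hgf : ∀ x, g (f x) = x := fun x => LinearMap.congr_fun hg x
  apply le_antisymm
  · intro m hm
    obtain ⟨w, rfl⟩ := mem_negGraph.1 hm
    have hw : w ∈ LinearMap.range f ⊔ Z.comap W.subtype := hZ ▸ Submodule.mem_top
    obtain ⟨_, ⟨u, rfl⟩, z, hz, rfl⟩ := Submodule.mem_sup.1 hw
    rw [map_add, hgf, hgZ z hz, add_zero]
    refine Submodule.mem_sup.2 ⟨-((u : M) - f u),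
      Submodule.neg_mem _ (sub_mem_negGraph f u), z, hz, ?_⟩
    rw [Submodule.coe_add]
    abel
  · refine sup_le ?_ ?_
    · intro m hm
      obtain ⟨u, rfl⟩ := mem_negGraph.1 hm
      refine mem_negGraph.2 ⟨-f u, ?_⟩
      rw [map_neg, hgf, Submodule.coe_neg, Submodule.coe_neg]
      abel
    · intro m hm
      refine mem_negGraph.2 ⟨⟨m, hZW hm⟩, ?_⟩
      rw [hgZ _ hm]
      simp

end Graph

/-! ### Stable frames -/

section Frame

theorem Finset.SupIndep.map_boundedLatticeHom {ι L L' : Type*} [Lattice L] [BoundedOrder L] [Lattice L']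
    [BoundedOrder L'] (f : BoundedLatticeHom L L') {s : Finset ι} {a : ι → L}
    (h : s.SupIndep a) : s.SupIndep (fun i => f (a i)) := by
  intro t hts i hi hit
  have := h hts hi hit
  rw [disjoint_iff] at this ⊢
  have e : t.sup (fun i => f (a i)) = f (t.sup a) := (map_finset_sup f t a).symm
  rw [e, ← map_inf, this, map_bot]

/-- Stability consists of bounded-lattice identities only, so no orthocomplement has to be
preserved. The same lemma serves `ι` and the inclusion into all right ideals. -/
theorem FrameData.IsStableFrame.map {L L' : Type*} [Lattice L] [BoundedOrder L] [Lattice L']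
    [BoundedOrder L'] {n k : ℕ} {Φ : FrameData L} (h : Φ.IsStableFrame n k)
    (f : BoundedLatticeHom L L') : (Φ.map f).IsStableFrame n k where
  indep := h.indep.map_boundedLatticeHom f
  span := by
    have := congrArg f h.span
    rwa [map_finset_sup, map_top] at this
  persp i h0 hi := by
    obtain ⟨h1, h2, h3, h4⟩ := h.persp i h0 hi
    simp only [FrameData.map, ← map_inf, ← map_sup]
    simp only [h1, h2, h3, h4, map_bot, and_self]
  subpersp i h0 hi := by
    obtain ⟨h1, h2, h3, h4⟩ := h.subpersp i h0 hi
    simp only [FrameData.map, ← map_inf, ← map_sup]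
    simp only [h1, h2, h3, h4, map_bot, and_self]
  ax_zero i h0 hi := congrArg f (h.ax_zero i h0 hi)
  ax_eq i j h0 hi h0' hj hij := by
    simp only [FrameData.map, ← map_inf, ← map_sup, h.ax_eq i j h0 hi h0' hj hij]
  z_compl i j hj hi hi' := by
    obtain ⟨h1, h2⟩ := h.z_compl i j hj hi hi'
    simp only [FrameData.image] at h1 h2
    simp only [FrameData.image, FrameData.map, ← map_inf, ← map_sup, h1, h2, map_bot, and_self]

section Lattice

variable {L : Type*} [Lattice L] [BoundedOrder L] {n k : ℕ} {Φ : FrameData L}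

theorem FrameData.IsFrame.disjoint (h : Φ.IsFrame n k) {i j : ℕ} (hi : i < n + k)
    (hj : j < n + k) (hij : i ≠ j) : Disjoint (Φ.a i) (Φ.a j) :=
  h.indep.pairwiseDisjoint (by simpa using hi) (by simpa using hj) hij

theorem FrameData.IsFrame.disjoint_sup (h : Φ.IsFrame n k) {i j l : ℕ} (hi : i < n + k)
    (hj : j < n + k) (hl : l < n + k) (hij : i ≠ j) (hil : i ≠ l) :
    Disjoint (Φ.a i) (Φ.a j ⊔ Φ.a l) := by
  have : Disjoint (Φ.a i) (({j, l} : Finset ℕ).sup Φ.a) := by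
    refine h.indep ?_ (by simpa using hi) (by simp [hij, hil])
    intro x hx
    rcases Finset.mem_insert.1 hx with rfl | hx
    · simpa using hj
    · rw [Finset.mem_singleton.1 hx]
      simpa using hl
  simpa using this

/-- The common content of perspectivity and subperspectivity: `ax 0 j` is the graph of an injective
morphism `a j → a 0`. -/
theorem FrameData.IsFrame.axis (h : Φ.IsFrame n k) {j : ℕ} (h0 : 0 < j) (hj : j < n + k) :
    Disjoint (Φ.ax 0 j) (Φ.a 0) ∧ Φ.ax 0 j ⊔ Φ.a 0 = Φ.a j ⊔ Φ.a 0 ∧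
      Disjoint (Φ.ax 0 j) (Φ.a j) := by
  rcases lt_or_ge j n with hjn | hjn
  · obtain ⟨h1, h2, h3, -⟩ := h.persp j h0 hjn
    refine ⟨(disjoint_iff.2 h1).symm, ?_, (disjoint_iff.2 h3).symm⟩
    rw [sup_comm, h2, sup_comm]
  · obtain ⟨h1, h2, h3, h4⟩ := h.subpersp j hjn hj
    refine ⟨?_, ?_, (disjoint_iff.2 h1).symm⟩
    · rw [disjoint_iff, eq_bot_iff, ← h3]
      exact le_inf (le_inf inf_le_right (inf_le_left.trans le_sup_right)) inf_le_left
    · apply le_antisymm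
      · refine sup_le (le_trans (le_sup_right.trans h2.ge) ?_) le_sup_right
        exact sup_le (inf_le_left.trans le_sup_right) le_sup_left
      · refine sup_le (le_trans (le_sup_left.trans h4.ge) ?_) le_sup_right
        exact sup_le (inf_le_left.trans le_sup_right) le_sup_left

end Lattice

variable {S : Type*} [Ring S] {M : Type*} [AddCommGroup M] [Module S M] {n k : ℕ}
  {Ψ : FrameData (Submodule S M)}

theorem FrameData.eps_self (n i : ℕ) (Ψ : FrameData (Submodule S M)) :
    Ψ.eps n i i = LinearMap.id := by
  rw [FrameData.eps, dif_pos rfl]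
  rfl

theorem FrameData.eps_zero_left (hn : 0 < n) {j : ℕ} (h0 : 0 < j) :
    Ψ.eps n 0 j = ofNegGraph (Ψ.a j) (Ψ.a 0) (Ψ.ax 0 j) := by
  rw [FrameData.eps, dif_neg h0.ne, if_pos hn]

theorem FrameData.IsStableFrame.negGraph_eps_zero_left (h : Ψ.IsStableFrame n k) (hn : 0 < n)
    {j : ℕ} (h0 : 0 < j) (hj : j < n + k) : negGraph (Ψ.eps n 0 j) = Ψ.ax 0 j := by
  obtain ⟨h1, h2, -⟩ := h.axis h0 hj
  rw [FrameData.eps_zero_left hn h0]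
  exact negGraph_ofNegGraph (h.disjoint hj (by omega) h0.ne') h1 h2

theorem FrameData.IsStableFrame.negGraph_eps_zero_right (h : Ψ.IsStableFrame n k)
    {j : ℕ} (h0 : 0 < j) (hj : j < n) : negGraph (Ψ.eps n j 0) = Ψ.ax 0 j := by
  obtain ⟨h1, h2, h3⟩ := h.axis h0 (Nat.lt_add_right k hj)
  obtain ⟨-, -, -, h4⟩ := h.persp j h0 hj
  rw [FrameData.eps, dif_neg h0.ne', if_pos hj, h.ax_zero j h0 hj]
  refine negGraph_ofNegGraph (h.disjoint (by omega) (by omega) h0.ne) h3 ?_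
  rw [sup_comm, h4]

theorem FrameData.IsStableFrame.eps_injective (h : Ψ.IsStableFrame n k) (hn : 0 < n)
    {j : ℕ} (h0 : 0 < j) (hj : j < n + k) : Function.Injective (Ψ.eps n 0 j) := by
  obtain ⟨-, -, h3⟩ := h.axis h0 hj
  rw [injective_iff_map_eq_zero]
  intro x hx
  have hm := sub_mem_negGraph (Ψ.eps n 0 j) x
  rw [hx, h.negGraph_eps_zero_left hn h0 hj, Submodule.coe_zero, sub_zero] at hm
  exact Subtype.ext (Submodule.disjoint_def.1 h3 _ hm x.2)

theorem FrameData.IsStableFrame.isCompl_range_eps (h : Ψ.IsStableFrame n k) (hn : 0 < n)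
    {j : ℕ} (hnj : n ≤ j) (hj : j < n + k) :
    IsCompl (LinearMap.range (Ψ.eps n 0 j)) ((Ψ.z j 0).comap (Ψ.a 0).subtype) := by
  have h0 : 0 < j := by omega
  obtain ⟨hi, hs⟩ := h.z_compl j 0 hn hnj hj
  have hr : ∀ w : Ψ.a 0, w ∈ LinearMap.range (Ψ.eps n 0 j) ↔ (w : M) ∈ Ψ.image 0 j := by
    intro w
    rw [mem_range_iff_of_disjoint (h.disjoint hj (by omega) h0.ne'),
      h.negGraph_eps_zero_left hn h0 hj]
    rfl
  constructor
  · rw [Submodule.disjoint_def]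
    intro w hw hz
    have : (w : M) ∈ Ψ.image 0 j ⊓ Ψ.z j 0 := ⟨(hr w).1 hw, hz⟩
    rw [hi] at this
    exact Subtype.ext this
  · rw [codisjoint_iff, eq_top_iff]
    rintro ⟨w, hw⟩ -
    rw [← hs] at hw
    obtain ⟨u, hu, z, hz, rfl⟩ := Submodule.mem_sup.1 hw
    have hz' : z ∈ Ψ.a 0 := hs ▸ Submodule.mem_sup_right hz
    exact Submodule.mem_sup.2 ⟨⟨u, hu.1⟩, (hr _).2 hu, ⟨z, hz'⟩, hz, rfl⟩

theorem FrameData.IsStableFrame.eps_spec (h : Ψ.IsStableFrame n k) (hn : 0 < n)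
    {j : ℕ} (hnj : n ≤ j) (hj : j < n + k) :
    Ψ.eps n j 0 ∘ₗ Ψ.eps n 0 j = LinearMap.id ∧
      ∀ w : Ψ.a 0, (w : M) ∈ Ψ.z j 0 → Ψ.eps n j 0 w = 0 := by
  have h0 : 0 < j := by omega
  have e : Ψ.eps n j 0 = leftInverseVanishingOn (Ψ.eps n 0 j) (Ψ.z j 0) := by
    rw [FrameData.eps, dif_neg h0.ne', if_neg (by omega), if_pos hn,
      FrameData.eps_zero_left hn h0]
  rw [e]
  exact leftInverseVanishingOn_spec (h.eps_injective hn h0 hj) (h.isCompl_range_eps hn hnj hj)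

theorem FrameData.IsStableFrame.negGraph_eps_zero_right_of_le (h : Ψ.IsStableFrame n k)
    (hn : 0 < n) {j : ℕ} (hnj : n ≤ j) (hj : j < n + k) :
    negGraph (Ψ.eps n j 0) = Ψ.ax 0 j ⊔ Ψ.z j 0 := by
  obtain ⟨h1, h2⟩ := h.eps_spec hn hnj hj
  have hz : Ψ.z j 0 ≤ Ψ.a 0 := le_sup_right.trans (h.z_compl j 0 hn hnj hj).2.le
  rw [negGraph_of_leftInverse hz (h.isCompl_range_eps hn hnj hj).sup_eq_top h1 h2,
    h.negGraph_eps_zero_left hn (by omega) hj]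

theorem FrameData.IsStableFrame.eps_comp_eps (h : Ψ.IsStableFrame n k)
    (hn : 0 < n) {j : ℕ} (hj : j < n + k) :
    Ψ.eps n j 0 ∘ₗ Ψ.eps n 0 j = LinearMap.id := by
  rcases Nat.eq_zero_or_pos j with rfl | h0
  · rw [FrameData.eps_self]
    rfl
  rcases lt_or_ge j n with hjn | hjn
  · refine negGraph_inverse (h.disjoint hj (by omega) h0.ne') ?_
    rw [h.negGraph_eps_zero_left hn h0 hj, h.negGraph_eps_zero_right h0 hjn]
  · exact (h.eps_spec hn hjn hj).1

/-- Restricted to `j < n`, where both morphisms have the same graph. For `j ≥ n` the composite is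
only an idempotent, the projection of `a 0` onto the image of `a j`. -/
theorem FrameData.IsStableFrame.eps_zero_comp_eps (h : Ψ.IsStableFrame n k) {j : ℕ}
    (hj : j < n) : Ψ.eps n 0 j ∘ₗ Ψ.eps n j 0 = LinearMap.id := by
  rcases Nat.eq_zero_or_pos j with rfl | h0
  · rw [FrameData.eps_self]
    rfl
  · refine negGraph_inverse (h.disjoint (by omega) (by omega) h0.ne) ?_
    rw [h.negGraph_eps_zero_left (by omega) h0 (by omega), h.negGraph_eps_zero_right h0 hj]

end Frame

/-! ### Transfer of morphisms along a lattice homomorphism -/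

section Transfer

variable {R : Type*} [Ring R] [StarRing R] [IsStarRegularRing R]
  {T : Type*} [Ring T] {M : Type*} [AddCommGroup M] [Module T M]

variable (R) in
/-- The inclusion of the lattice of principal right ideals into that of all right ideals. -/
def principalRightIdealsIncl :
    BoundedLatticeHom (principalRightIdeals R) (Submodule Rᵐᵒᵖ R) where
  toFun I := I
  map_sup' _ _ := rfl
  map_inf' _ _ := rfl
  map_top' := rfl
  map_bot' := rfl

omit [StarRing R] [IsStarRegularRing R] in
-- If `p` generates `A`, then `p - f p` generates the graph. Consequently every endomorphism of `a
-- 0` belongs to the coefficient ring.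
theorem isPrincipal_negGraph {A B : Submodule Rᵐᵒᵖ R} (hA : A.IsPrincipal)
    (f : A →ₗ[Rᵐᵒᵖ] B) : (negGraph f).IsPrincipal := by
  obtain ⟨⟨p, rfl⟩⟩ := hA
  let p' : Submodule.span Rᵐᵒᵖ {p} := ⟨p, Submodule.mem_span_singleton_self p⟩
  refine ⟨⟨p - f p', le_antisymm ?_ ?_⟩⟩
  · intro m hm
    obtain ⟨x, rfl⟩ := mem_negGraph.1 hm
    obtain ⟨c, hc⟩ := Submodule.mem_span_singleton.1 x.2
    have hx : x = c • p' := Subtype.ext hc.symm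
    rw [hx, map_smul]
    exact Submodule.mem_span_singleton.2 ⟨c, smul_sub _ _ _⟩
  · rw [Submodule.span_singleton_le_iff_mem]
    exact sub_mem_negGraph f p'

/-- The graph of a morphism between principal right ideals. -/
def principalGraph {A B : principalRightIdeals R} (f : A.1 →ₗ[Rᵐᵒᵖ] B.1) :
    principalRightIdeals R :=
  ⟨negGraph f, isPrincipal_negGraph A.2 f⟩

variable (ι : BoundedLatticeHom (principalRightIdeals R) (Submodule T M))

/-- The morphism `ι A → ι B` whose graph is the image under `ι` of the graph of `f : A → B`. -/
noncomputable def graphMap {A B : principalRightIdeals R} (f : A.1 →ₗ[Rᵐᵒᵖ] B.1) :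
    ι A →ₗ[T] ι B :=
  ofNegGraph (ι A) (ι B) (ι (principalGraph f))

variable {ι} {A B C : principalRightIdeals R}

theorem Disjoint.coe_principalRightIdeals (h : Disjoint A B) : Disjoint A.1 B.1 :=
  h.map (principalRightIdealsIncl R)

theorem Disjoint.map_sup_right {L L' : Type*} [Lattice L] [BoundedOrder L] [Lattice L']
    [BoundedOrder L'] {a b c : L} (h : Disjoint a (b ⊔ c)) (f : BoundedLatticeHom L L') :
    Disjoint (f a) (f b ⊔ f c) := by
  rw [← map_sup]
  exact h.map f

/-- Being a complement of `B` in `[0, A + B]` is preserved by `ι`, so the image of a graph is again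
a graph and the default value of `ofNegGraph` does not arise. -/
theorem negGraph_graphMap (h : Disjoint A B) (f : A.1 →ₗ[Rᵐᵒᵖ] B.1) :
    negGraph (graphMap ι f) = ι (principalGraph f) := by
  refine negGraph_ofNegGraph (h.map ι) ?_ ?_
  · have hd : Disjoint (principalGraph f) B := disjoint_iff.2
      (Subtype.ext (disjoint_iff.1 (disjoint_negGraph h.coe_principalRightIdeals f)))
    exact hd.map ι
  · rw [← map_sup, ← map_sup]
    exact congrArg ι (Subtype.ext (negGraph_sup f))

/-- The transfer principle: one lattice element `G` describing the graph on both sides suffices. -/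
theorem graphMap_eq (h : Disjoint A B) {f : A.1 →ₗ[Rᵐᵒᵖ] B.1} {g : ι A →ₗ[T] ι B}
    (G : principalRightIdeals R) (hf : negGraph f = G.1) (hg : negGraph g = ι G) :
    graphMap ι f = g := by
  apply negGraph_injective (h.map ι)
  rw [negGraph_graphMap h, hg]
  exact congrArg ι (Subtype.ext hf)

theorem graphMap_injective (hι : Function.Injective ι) (h : Disjoint A B)
    {f g : A.1 →ₗ[Rᵐᵒᵖ] B.1} (hfg : graphMap ι f = graphMap ι g) : f = g := by
  apply negGraph_injective h.coe_principalRightIdeals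
  have := congrArg negGraph hfg
  rw [negGraph_graphMap h, negGraph_graphMap h] at this
  exact congrArg Subtype.val (hι this)

theorem graphMap_comp (hB : Disjoint B (A ⊔ C)) (hAC : Disjoint A C)
    (f : A.1 →ₗ[Rᵐᵒᵖ] B.1) (g : B.1 →ₗ[Rᵐᵒᵖ] C.1) :
    graphMap ι (g ∘ₗ f) = graphMap ι g ∘ₗ graphMap ι f := by
  refine graphMap_eq hAC ((principalGraph f ⊔ principalGraph g) ⊓ (A ⊔ C))
    (negGraph_comp hB.coe_principalRightIdeals f g) ?_
  rw [negGraph_comp (hB.map_sup_right ι),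
    negGraph_graphMap (hB.mono_right le_sup_left).symm,
    negGraph_graphMap (hB.mono_right le_sup_right), map_inf, map_sup, map_sup]

theorem graphMap_add_comp (hA : Disjoint A (B ⊔ C)) (hBC : Disjoint B C)
    (hC : Disjoint C (A ⊔ B)) (f : A.1 →ₗ[Rᵐᵒᵖ] B.1) (e : A.1 →ₗ[Rᵐᵒᵖ] C.1)
    (g : C.1 →ₗ[Rᵐᵒᵖ] B.1) :
    graphMap ι (f + g ∘ₗ e) = graphMap ι f + graphMap ι g ∘ₗ graphMap ι e := by
  refine graphMap_eq (hA.mono_right le_sup_left)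
    ((((principalGraph f ⊔ C) ⊓ (principalGraph e ⊔ B)) ⊔ principalGraph g) ⊓ (A ⊔ B))
    (negGraph_add_comp hA.coe_principalRightIdeals hBC.coe_principalRightIdeals
      hC.coe_principalRightIdeals f e g) ?_
  rw [negGraph_add_comp (hA.map_sup_right ι) (hBC.map ι) (hC.map_sup_right ι),
    negGraph_graphMap (hA.mono_right le_sup_left), negGraph_graphMap hBC.symm,
    negGraph_graphMap (hA.mono_right le_sup_right)]
  simp only [map_inf, map_sup]

namespace FrameData

/-- A frame of principal right ideals as a frame in the lattice of all right ideals. -/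
abbrev ideals (Φ : FrameData (principalRightIdeals R)) : FrameData (Submodule Rᵐᵒᵖ R) :=
  Φ.map (↑)

variable {Φ : FrameData (principalRightIdeals R)} {k : ℕ}

theorem IsStableFrame.ideals {n : ℕ} (h : Φ.IsStableFrame n k) : Φ.ideals.IsStableFrame n k :=
  h.map (principalRightIdealsIncl R)

variable (ι) in
/-- The map `graphMap` for the components of a frame. -/
noncomputable def transfer {i j : ℕ} (f : Φ.ideals.a i →ₗ[Rᵐᵒᵖ] Φ.ideals.a j) :
    (Φ.map ι).a i →ₗ[T] (Φ.map ι).a j :=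
  graphMap (A := Φ.a i) (B := Φ.a j) ι f

theorem IsStableFrame.transfer_comp {n : ℕ} (h : Φ.IsStableFrame n k) {i j l : ℕ}
    (hi : i < n + k) (hj : j < n + k) (hl : l < n + k) (hij : i ≠ j) (hjl : j ≠ l) (hil : i ≠ l)
    (f : Φ.ideals.a i →ₗ[Rᵐᵒᵖ] Φ.ideals.a j) (g : Φ.ideals.a j →ₗ[Rᵐᵒᵖ] Φ.ideals.a l) :
    transfer ι (g ∘ₗ f) = transfer ι g ∘ₗ transfer ι f :=
  graphMap_comp (h.disjoint_sup hj hi hl hij.symm hjl) (h.disjoint hi hl hil) f g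

theorem IsStableFrame.transfer_eps_left {n : ℕ} (h : Φ.IsStableFrame n k) (hn : 0 < n) {j : ℕ}
    (h0 : 0 < j) (hj : j < n + k) :
    transfer ι (Φ.ideals.eps n 0 j) = (Φ.map ι).eps n 0 j :=
  graphMap_eq (h.disjoint hj (by omega) h0.ne') (Φ.ax 0 j)
    (h.ideals.negGraph_eps_zero_left hn h0 hj) ((h.map ι).negGraph_eps_zero_left hn h0 hj)

theorem IsStableFrame.transfer_eps_right {n : ℕ} (h : Φ.IsStableFrame n k) (hn : 0 < n) {j : ℕ}
    (h0 : 0 < j) (hj : j < n + k) :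
    transfer ι (Φ.ideals.eps n j 0) = (Φ.map ι).eps n j 0 := by
  have hd := h.disjoint (i := 0) (by omega) hj h0.ne
  rcases lt_or_ge j n with hjn | hjn
  · exact graphMap_eq hd (Φ.ax 0 j)
      (h.ideals.negGraph_eps_zero_right h0 hjn) ((h.map ι).negGraph_eps_zero_right h0 hjn)
  · refine graphMap_eq hd (Φ.ax 0 j ⊔ Φ.z j 0)
      (h.ideals.negGraph_eps_zero_right_of_le hn hjn hj) ?_
    rw [map_sup]
    exact (h.map ι).negGraph_eps_zero_right_of_le hn hjn hj

theorem etaCoefficient_eq {n : ℕ} (φ : Module.End Rᵐᵒᵖ (Φ.ideals.a 0)) :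
    etaCoefficient n (principalRightIdeals R) Φ ι φ =
      (Φ.map ι).eps n 0 1 ∘ₗ transfer ι (Φ.ideals.eps n 1 0 ∘ₗ φ) := by
  have h : φ ∈ coefficientRing n (principalRightIdeals R) Φ :=
    isPrincipal_negGraph (Φ.a 0).2 (Φ.ideals.eps n 1 0 ∘ₗ φ)
  rw [etaCoefficient, dif_pos h]
  rfl

variable (ι) in
/-- The map `η` on the coefficient ring of a frame of format `(3, k)`. -/
noncomputable def eta (φ : Module.End Rᵐᵒᵖ (Φ.ideals.a 0)) : Module.End T ((Φ.map ι).a 0) :=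
  (Φ.map ι).eps 3 0 1 ∘ₗ transfer ι (Φ.ideals.eps 3 1 0 ∘ₗ φ)

/-! ### The ring homomorphism `η` on endomorphisms of `a 0` -/

section Eta

variable {E : Type*} [AddCommGroup E] [Module T E]

theorem IsStableFrame.eps_comp_eps_comp {n : ℕ} {Ψ : FrameData (Submodule T M)}
    (h : Ψ.IsStableFrame n k) (hn : 0 < n) {j : ℕ} (hj : j < n + k) (f : E →ₗ[T] Ψ.a j) :
    Ψ.eps n j 0 ∘ₗ Ψ.eps n 0 j ∘ₗ f = f := by
  rw [← LinearMap.comp_assoc, h.eps_comp_eps hn hj, LinearMap.id_comp]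

theorem IsStableFrame.eps_zero_comp_eps_comp {n : ℕ} {Ψ : FrameData (Submodule T M)}
    (h : Ψ.IsStableFrame n k) {j : ℕ} (hj : j < n) (f : E →ₗ[T] Ψ.a 0) :
    Ψ.eps n 0 j ∘ₗ Ψ.eps n j 0 ∘ₗ f = f := by
  rw [← LinearMap.comp_assoc, h.eps_zero_comp_eps hj, LinearMap.id_comp]

variable (h : Φ.IsStableFrame 3 k)
include h

/-- The product is routed along `0 → 1 → 2 → 1`, bracketed so that each composition splits off over
three distinct indices. In `V` the inserted `ε'_{02} ε'_{20}` cancels. -/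
theorem IsStableFrame.eta_comp (ψ φ : Module.End Rᵐᵒᵖ (Φ.ideals.a 0)) :
    eta ι (ψ ∘ₗ φ) = eta ι ψ ∘ₗ eta ι φ := by
  have e : Φ.ideals.eps 3 1 0 ∘ₗ ψ ∘ₗ φ =
      ((Φ.ideals.eps 3 1 0 ∘ₗ ψ) ∘ₗ Φ.ideals.eps 3 0 2) ∘ₗ
        ((Φ.ideals.eps 3 2 0 ∘ₗ Φ.ideals.eps 3 0 1) ∘ₗ (Φ.ideals.eps 3 1 0 ∘ₗ φ)) := by
    simp only [LinearMap.comp_assoc]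
    rw [h.ideals.eps_zero_comp_eps_comp (by omega), h.ideals.eps_zero_comp_eps_comp (by omega)]
  rw [eta, eta, eta, e,
    h.transfer_comp (i := 0) (j := 2) (l := 1) (by omega) (by omega) (by omega)
      (by omega) (by omega) (by omega),
    h.transfer_comp (i := 2) (j := 0) (l := 1) (by omega) (by omega) (by omega)
      (by omega) (by omega) (by omega),
    h.transfer_comp (i := 0) (j := 1) (l := 2) (by omega) (by omega) (by omega)
      (by omega) (by omega) (by omega),
    h.transfer_comp (i := 1) (j := 0) (l := 2) (by omega) (by omega) (by omega)
      (by omega) (by omega) (by omega),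
    h.transfer_eps_left (by omega) (by omega) (by omega),
    h.transfer_eps_left (by omega) (by omega) (by omega),
    h.transfer_eps_right (by omega) (by omega) (by omega)]
  simp only [LinearMap.comp_assoc]
  rw [(h.map ι).eps_zero_comp_eps_comp (by omega)]

theorem IsStableFrame.eta_id :
    eta ι (LinearMap.id : Module.End Rᵐᵒᵖ (Φ.ideals.a 0)) = LinearMap.id := by
  rw [eta, LinearMap.comp_id, h.transfer_eps_right (by omega) (by omega) (by omega),
    (h.map ι).eps_zero_comp_eps (by omega)]

theorem IsStableFrame.eta_add (φ ψ : Module.End Rᵐᵒᵖ (Φ.ideals.a 0)) :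
    eta ι (φ + ψ) = eta ι φ + eta ι ψ := by
  -- The second summand is detoured through `a 2` to reach the form `f + g ∘ e` of
  -- `graphMap_add_comp`.
  have e : Φ.ideals.eps 3 1 0 ∘ₗ (φ + ψ) = Φ.ideals.eps 3 1 0 ∘ₗ φ +
      ((Φ.ideals.eps 3 1 0 ∘ₗ ψ) ∘ₗ Φ.ideals.eps 3 0 2) ∘ₗ Φ.ideals.eps 3 2 0 := by
    rw [LinearMap.comp_assoc (Φ.ideals.eps 3 2 0),
      h.ideals.eps_zero_comp_eps (by omega), LinearMap.comp_id, LinearMap.comp_add]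
  have e' : transfer ι (Φ.ideals.eps 3 1 0 ∘ₗ φ +
      ((Φ.ideals.eps 3 1 0 ∘ₗ ψ) ∘ₗ Φ.ideals.eps 3 0 2) ∘ₗ Φ.ideals.eps 3 2 0) =
      transfer ι (Φ.ideals.eps 3 1 0 ∘ₗ φ) +
      transfer ι ((Φ.ideals.eps 3 1 0 ∘ₗ ψ) ∘ₗ Φ.ideals.eps 3 0 2) ∘ₗ
        transfer ι (Φ.ideals.eps 3 2 0) :=
    graphMap_add_comp (h.disjoint_sup (by omega) (by omega) (by omega) (by omega) (by omega))
      (h.disjoint (by omega) (by omega) (by omega))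
      (h.disjoint_sup (by omega) (by omega) (by omega) (by omega) (by omega)) _ _ _
  rw [eta, eta, eta, e, e',
    h.transfer_comp (i := 2) (j := 0) (l := 1) (by omega) (by omega) (by omega)
      (by omega) (by omega) (by omega),
    h.transfer_eps_left (by omega) (by omega) (by omega),
    h.transfer_eps_right (by omega) (by omega) (by omega), LinearMap.comp_assoc,
    (h.map ι).eps_zero_comp_eps (by omega), LinearMap.comp_id, LinearMap.comp_add]

theorem IsStableFrame.eta_injective (hι : Function.Injective ι)
    {φ ψ : Module.End Rᵐᵒᵖ (Φ.ideals.a 0)} (hφψ : eta ι φ = eta ι ψ) : φ = ψ := by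
  have h1 := congrArg (fun f => (Φ.map ι).eps 3 1 0 ∘ₗ f) hφψ
  simp only [eta] at h1
  rw [(h.map ι).eps_comp_eps_comp (by omega) (by omega),
    (h.map ι).eps_comp_eps_comp (by omega) (by omega)] at h1
  have h2 : Φ.ideals.eps 3 1 0 ∘ₗ φ = Φ.ideals.eps 3 1 0 ∘ₗ ψ :=
    graphMap_injective hι (h.disjoint (by omega) (by omega) (by omega)) h1
  have h3 := congrArg (fun f => Φ.ideals.eps 3 0 1 ∘ₗ f) h2
  rwa [h.ideals.eps_zero_comp_eps_comp (by omega),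
    h.ideals.eps_zero_comp_eps_comp (by omega)] at h3

/-- For `j ≥ 3` the indices `0`, `j`, `1` are distinct, so the idempotent can be transferred factor
by factor. These idempotents make `cell` multiplicative through the smaller components. -/
theorem IsStableFrame.eta_eps {j : ℕ} (hj : j < 3 + k) :
    eta ι (Φ.ideals.eps 3 0 j ∘ₗ Φ.ideals.eps 3 j 0) =
      (Φ.map ι).eps 3 0 j ∘ₗ (Φ.map ι).eps 3 j 0 := by
  rcases lt_or_ge j 3 with hj3 | hj3
  · rw [h.ideals.eps_zero_comp_eps hj3, (h.map ι).eps_zero_comp_eps hj3, h.eta_id]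
  · rw [eta, ← LinearMap.comp_assoc,
      h.transfer_comp (i := 0) (j := j) (l := 1) (by omega) (by omega) (by omega)
        (by omega) (by omega) (by omega),
      h.transfer_comp (i := j) (j := 0) (l := 1) (by omega) (by omega) (by omega)
        (by omega) (by omega) (by omega),
      h.transfer_eps_left (by omega) (by omega) (by omega),
      h.transfer_eps_right (by omega) (by omega) (by omega),
      h.transfer_eps_right (by omega) (by omega) (by omega), LinearMap.comp_assoc,
      (h.map ι).eps_zero_comp_eps_comp (by omega)]

end Eta

end FrameData

end Transfer

namespace FrameData

/-! ### Decompositions belonging to a frame of submodules -/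

section Decomposition

variable {S : Type*} [Ring S] {M : Type*} [AddCommGroup M] [Module S M] {n k : ℕ}
  {Ψ : FrameData (Submodule S M)} (h : Ψ.IsFrame n k)
include h

theorem IsFrame.isCompl {i : ℕ} (hi : i < n + k) :
    IsCompl (Ψ.a i) (((Finset.range (n + k)).erase i).sup Ψ.a) := by
  have hi' : i ∈ Finset.range (n + k) := Finset.mem_range.2 hi
  refine ⟨h.indep (Finset.erase_subset _ _) hi' (Finset.notMem_erase _ _), ?_⟩
  rw [codisjoint_iff, ← h.span, ← Finset.sup_insert, Finset.insert_erase hi']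

theorem IsFrame.frameProj_eq {i : ℕ} (hi : i < n + k) :
    frameProj Ψ.a (n + k) i = Submodule.projectionOnto _ _ (h.isCompl hi) := by
  rw [frameProj, dif_pos (h.isCompl hi)]

theorem IsFrame.frameProj_apply {i : ℕ} (hi : i < n + k) (x : Ψ.a i) :
    frameProj Ψ.a (n + k) i x = x := by
  rw [h.frameProj_eq hi]
  exact Submodule.projectionOnto_apply_left _ x

theorem IsFrame.frameProj_apply_ne {i j : ℕ} (hi : i < n + k) (hj : j < n + k) (hij : i ≠ j)
    (x : Ψ.a j) : frameProj Ψ.a (n + k) i x = 0 := by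
  rw [h.frameProj_eq hi, Submodule.projectionOnto_apply_eq_zero_iff]
  exact Finset.le_sup (f := Ψ.a)
    (Finset.mem_erase.2 ⟨hij.symm, Finset.mem_range.2 hj⟩) x.2

theorem IsFrame.sub_frameProj_mem {i : ℕ} (hi : i < n + k) (x : M) :
    x - frameProj Ψ.a (n + k) i x ∈ ((Finset.range (n + k)).erase i).sup Ψ.a := by
  rw [← Submodule.projectionOnto_apply_eq_zero_iff (h.isCompl hi), map_sub, h.frameProj_eq hi,
    Submodule.projectionOnto_apply_left, sub_self]

theorem IsFrame.induction {p : M → Prop} (mem : ∀ i < n + k, ∀ x : Ψ.a i, p x) (zero : p 0)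
    (add : ∀ x y, p x → p y → p (x + y)) (x : M) : p x := by
  have key : ∀ s ⊆ Finset.range (n + k), ∀ x ∈ s.sup Ψ.a, p x := by
    intro s
    induction s using Finset.induction_on with
    | empty =>
      intro _ x hx
      rw [Finset.sup_empty, Submodule.mem_bot] at hx
      exact hx ▸ zero
    | insert i s _ ih =>
      intro hs x hx
      rw [Finset.sup_insert] at hx
      obtain ⟨y, hy, z, hz, rfl⟩ := Submodule.mem_sup.1 hx
      exact add _ _ (mem i (Finset.mem_range.1 (hs (Finset.mem_insert_self _ _))) ⟨y, hy⟩)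
        (ih ((Finset.subset_insert _ _).trans hs) z hz)
  exact key _ subset_rfl x (h.span ▸ Submodule.mem_top)

theorem IsFrame.end_ext {f g : Module.End S M} (hfg : ∀ i < n + k, ∀ x : Ψ.a i, f x = g x) :
    f = g := by
  ext x
  refine h.induction (p := fun x => f x = g x) hfg (by rw [map_zero, map_zero]) ?_ x
  intro x y hx hy
  rw [map_add, map_add, hx, hy]

/-- By additivity it is enough to check elements of a single component. -/
theorem IsFrame.sum_frameProj (x : M) :
    ∑ i ∈ Finset.range (n + k), (frameProj Ψ.a (n + k) i x : M) = x := by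
  refine h.induction (p := fun x => ∑ i ∈ Finset.range (n + k),
    (frameProj Ψ.a (n + k) i x : M) = x) ?_ (by simp) ?_ x
  · intro i hi x
    rw [Finset.sum_eq_single i, h.frameProj_apply hi]
    · intro j hj hji
      rw [h.frameProj_apply_ne (Finset.mem_range.1 hj) hi hji, Submodule.coe_zero]
    · exact fun hi' => absurd (Finset.mem_range.2 hi) hi'
  · intro x y hx hy
    simp only [map_add, Submodule.coe_add, Finset.sum_add_distrib, hx, hy]

theorem IsFrame.frameComponent_mul (φ ψ : Module.End S M) (l i : ℕ) :
    frameComponent Ψ.a (n + k) (φ * ψ) l i = ∑ j ∈ Finset.range (n + k),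
      frameComponent Ψ.a (n + k) φ l j ∘ₗ frameComponent Ψ.a (n + k) ψ j i := by
  ext x : 1
  simp only [frameComponent, LinearMap.sum_apply, LinearMap.comp_apply, Submodule.subtype_apply,
    Module.End.mul_apply]
  rw [← map_sum, ← map_sum, h.sum_frameProj]

theorem IsFrame.frameComponent_one_self {i : ℕ} (hi : i < n + k) :
    frameComponent Ψ.a (n + k) 1 i i = LinearMap.id := by
  ext x : 1
  exact h.frameProj_apply hi x

theorem IsFrame.frameComponent_one_ne {i j : ℕ} (hi : i < n + k) (hj : j < n + k) (hij : i ≠ j) :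
    frameComponent Ψ.a (n + k) 1 i j = 0 := by
  ext x : 1
  exact h.frameProj_apply_ne hi hj hij x

omit h in
theorem frameComponent_add (φ ψ : Module.End S M) (i j : ℕ) :
    frameComponent Ψ.a (n + k) (φ + ψ) i j =
      frameComponent Ψ.a (n + k) φ i j + frameComponent Ψ.a (n + k) ψ i j := by
  rw [frameComponent, LinearMap.add_comp, LinearMap.comp_add]
  rfl

theorem IsFrame.eq_zero_of_frameComponent {φ : Module.End S M}
    (hφ : ∀ i < n + k, ∀ j < n + k, frameComponent Ψ.a (n + k) φ j i = 0) : φ = 0 := by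
  refine h.end_ext fun i hi x => ?_
  rw [← h.sum_frameProj (φ x), LinearMap.zero_apply]
  refine Finset.sum_eq_zero fun j hj => ?_
  have := LinearMap.congr_fun (hφ i hi j (Finset.mem_range.1 hj)) x
  exact congrArg Subtype.val this

end Decomposition

/-! ### The map on the matrix ring -/

section Cell

variable {R : Type*} [Ring R] [StarRing R] [IsStarRegularRing R]
  {T : Type*} [Ring T] {M : Type*} [AddCommGroup M] [Module T M]
  {ι : BoundedLatticeHom (principalRightIdeals R) (Submodule T M)}
  {Φ : FrameData (principalRightIdeals R)} {k : ℕ}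

variable (ι) in
/-- The map `η` on the components `a i → a j`. -/
noncomputable def cell {i j : ℕ} (f : Φ.ideals.a i →ₗ[Rᵐᵒᵖ] Φ.ideals.a j) :
    (Φ.map ι).a i →ₗ[T] (Φ.map ι).a j :=
  (Φ.map ι).eps 3 j 0 ∘ₗ eta ι (Φ.ideals.eps 3 0 j ∘ₗ f ∘ₗ Φ.ideals.eps 3 i 0) ∘ₗ
    (Φ.map ι).eps 3 0 i

variable (h : Φ.IsStableFrame 3 k)
include h

theorem IsStableFrame.cell_add {i j : ℕ} (f g : Φ.ideals.a i →ₗ[Rᵐᵒᵖ] Φ.ideals.a j) :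
    cell ι (f + g) = cell ι f + cell ι g := by
  simp only [cell, LinearMap.add_comp, LinearMap.comp_add, h.eta_add]

theorem IsStableFrame.cell_zero {i j : ℕ} :
    cell ι (0 : Φ.ideals.a i →ₗ[Rᵐᵒᵖ] Φ.ideals.a j) = 0 := by
  have := h.cell_add (ι := ι) (0 : Φ.ideals.a i →ₗ[Rᵐᵒᵖ] Φ.ideals.a j) 0
  simpa using this

theorem IsStableFrame.cell_neg {i j : ℕ} (f : Φ.ideals.a i →ₗ[Rᵐᵒᵖ] Φ.ideals.a j) :
    cell ι (-f) = -cell ι f :=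
  map_neg (AddMonoidHom.mk' (cell ι) h.cell_add) f

theorem IsStableFrame.cell_sum {i j : ℕ} (s : Finset ℕ)
    (f : ℕ → (Φ.ideals.a i →ₗ[Rᵐᵒᵖ] Φ.ideals.a j)) :
    cell ι (∑ l ∈ s, f l) = ∑ l ∈ s, cell ι (f l) :=
  map_sum (AddMonoidHom.mk' (cell ι) h.cell_add) f s

theorem IsStableFrame.cell_id {i : ℕ} (hi : i < 3 + k) :
    cell ι (LinearMap.id : Φ.ideals.a i →ₗ[Rᵐᵒᵖ] Φ.ideals.a i) = LinearMap.id := by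
  rw [cell, LinearMap.id_comp, h.eta_eps hi, LinearMap.comp_assoc,
    (h.map ι).eps_comp_eps_comp (by omega) hi, (h.map ι).eps_comp_eps (by omega) hi]

/-- The idempotent `ε_{0j} ε_{j0}` can be inserted between the two conjugated factors, and `η` sends
it to the middle term `ε'_{0j} ε'_{j0}` of the composite in `V`. No distinctness of indices is
required here. -/
theorem IsStableFrame.cell_comp {i j l : ℕ} (hj : j < 3 + k)
    (g : Φ.ideals.a j →ₗ[Rᵐᵒᵖ] Φ.ideals.a l) (f : Φ.ideals.a i →ₗ[Rᵐᵒᵖ] Φ.ideals.a j) :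
    cell ι (g ∘ₗ f) = cell ι g ∘ₗ cell ι f := by
  have e : Φ.ideals.eps 3 0 l ∘ₗ (g ∘ₗ f) ∘ₗ Φ.ideals.eps 3 i 0 =
      (Φ.ideals.eps 3 0 l ∘ₗ g ∘ₗ Φ.ideals.eps 3 j 0) ∘ₗ
        (Φ.ideals.eps 3 0 j ∘ₗ Φ.ideals.eps 3 j 0) ∘ₗ
          (Φ.ideals.eps 3 0 j ∘ₗ f ∘ₗ Φ.ideals.eps 3 i 0) := by
    simp only [LinearMap.comp_assoc]
    rw [h.ideals.eps_comp_eps_comp (by omega) hj, h.ideals.eps_comp_eps_comp (by omega) hj]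
  rw [cell, e, h.eta_comp, h.eta_comp, h.eta_eps hj, cell, cell]
  simp only [LinearMap.comp_assoc]

theorem IsStableFrame.cell_injective (hι : Function.Injective ι) {i j : ℕ} (hi : i < 3 + k)
    (hj : j < 3 + k) {f : Φ.ideals.a i →ₗ[Rᵐᵒᵖ] Φ.ideals.a j} (hf : cell ι f = 0) : f = 0 := by
  have h1 : eta ι (Φ.ideals.eps 3 0 j ∘ₗ f ∘ₗ Φ.ideals.eps 3 i 0) = 0 := by
    -- The conjugate of `f` absorbs the idempotents at `j` and `i`, so its image under `η` can be
    -- rebuilt from `cell ι f`.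
    have e : Φ.ideals.eps 3 0 j ∘ₗ f ∘ₗ Φ.ideals.eps 3 i 0 =
        (Φ.ideals.eps 3 0 j ∘ₗ Φ.ideals.eps 3 j 0) ∘ₗ
          (Φ.ideals.eps 3 0 j ∘ₗ f ∘ₗ Φ.ideals.eps 3 i 0) ∘ₗ
            (Φ.ideals.eps 3 0 i ∘ₗ Φ.ideals.eps 3 i 0) := by
      simp only [LinearMap.comp_assoc]
      rw [h.ideals.eps_comp_eps_comp (by omega) hj, h.ideals.eps_comp_eps_comp (by omega) hi]
    rw [e, h.eta_comp, h.eta_comp, h.eta_eps hi, h.eta_eps hj]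
    have := congrArg (fun u => (Φ.map ι).eps 3 0 j ∘ₗ u ∘ₗ (Φ.map ι).eps 3 i 0) hf
    simpa only [cell, LinearMap.comp_assoc, LinearMap.zero_comp, LinearMap.comp_zero] using this
  have h0 : eta ι (0 : Module.End Rᵐᵒᵖ (Φ.ideals.a 0)) = 0 := by
    simpa using h.eta_add (ι := ι) (0 : Module.End Rᵐᵒᵖ (Φ.ideals.a 0)) 0
  have h2 := congrArg (fun u => Φ.ideals.eps 3 j 0 ∘ₗ u ∘ₗ Φ.ideals.eps 3 0 i)
    (h.eta_injective hι (h1.trans h0.symm))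
  simp only [LinearMap.comp_assoc, LinearMap.zero_comp, LinearMap.comp_zero] at h2
  rwa [h.ideals.eps_comp_eps_comp (by omega) hj, h.ideals.eps_comp_eps (by omega) hi,
    LinearMap.comp_id] at h2

theorem IsStableFrame.cell_eps_right {j : ℕ} (hj : j < 3 + k) :
    cell ι (Φ.ideals.eps 3 j 0) = (Φ.map ι).eps 3 j 0 := by
  rw [cell, eps_self, LinearMap.comp_id, h.eta_eps hj, eps_self, LinearMap.comp_id,
    (h.map ι).eps_comp_eps_comp (by omega) hj]

theorem IsStableFrame.cell_eps_left {j : ℕ} (hj : j < 3 + k) :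
    cell ι (Φ.ideals.eps 3 0 j) = (Φ.map ι).eps 3 0 j := by
  rw [cell, eps_self, eps_self, LinearMap.id_comp, LinearMap.id_comp, h.eta_eps hj,
    LinearMap.comp_assoc, (h.map ι).eps_comp_eps (by omega) hj, LinearMap.comp_id]

theorem IsStableFrame.cell_eq_transfer_one_zero (f : Φ.ideals.a 0 →ₗ[Rᵐᵒᵖ] Φ.ideals.a 1) :
    cell ι f = transfer ι f := by
  rw [cell, eps_self, eps_self, LinearMap.comp_id, LinearMap.comp_id, eta,
    h.ideals.eps_comp_eps_comp (by omega) (by omega),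
    (h.map ι).eps_comp_eps_comp (by omega) (by omega)]

theorem IsStableFrame.cell_eq_transfer_zero_right {j : ℕ} (h0 : 0 < j) (hj : j < 3 + k)
    (f : Φ.ideals.a 0 →ₗ[Rᵐᵒᵖ] Φ.ideals.a j) : cell ι f = transfer ι f := by
  by_cases hj1 : j = 1
  · subst hj1
    exact h.cell_eq_transfer_one_zero f
  have e : f = (Φ.ideals.eps 3 j 0 ∘ₗ Φ.ideals.eps 3 0 1) ∘ₗ
      (Φ.ideals.eps 3 1 0 ∘ₗ Φ.ideals.eps 3 0 j ∘ₗ f) := by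
    rw [LinearMap.comp_assoc, h.ideals.eps_zero_comp_eps_comp (by omega),
      h.ideals.eps_comp_eps_comp (by omega) hj]
  rw [e, h.cell_comp (by omega), h.cell_comp (by omega), h.cell_eps_right hj,
    h.cell_eps_left (by omega), h.cell_eq_transfer_one_zero,
    h.transfer_comp (i := 0) (j := 1) (l := j) (by omega) (by omega) hj (by omega)
      (by omega) (by omega),
    h.transfer_comp (i := 1) (j := 0) (l := j) (by omega) (by omega) hj (by omega)
      (by omega) (by omega),
    h.transfer_eps_right (by omega) h0 hj, h.transfer_eps_left (by omega) (by omega) (by omega)]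

/-- `cell` is defined through `a 0 → a 1`, where the two maps agree; other off-diagonal pairs are
reached by composing with `ε`'s over distinct indices. Orthogonality arguments need this, since they
apply to graphs. -/
theorem IsStableFrame.cell_eq_transfer {i j : ℕ} (hi : i < 3 + k) (hj : j < 3 + k)
    (hij : i ≠ j) (f : Φ.ideals.a i →ₗ[Rᵐᵒᵖ] Φ.ideals.a j) : cell ι f = transfer ι f := by
  have main : ∀ i < 3 + k, ∀ j < 3 + k, 0 < j → i ≠ j →
      ∀ f : Φ.ideals.a i →ₗ[Rᵐᵒᵖ] Φ.ideals.a j, cell ι f = transfer ι f := by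
    intro i hi j hj h0 hij f
    rcases Nat.eq_zero_or_pos i with rfl | hi0
    · exact h.cell_eq_transfer_zero_right h0 hj f
    have e : f = (f ∘ₗ Φ.ideals.eps 3 i 0) ∘ₗ Φ.ideals.eps 3 0 i := by
      rw [LinearMap.comp_assoc, h.ideals.eps_comp_eps (by omega) hi, LinearMap.comp_id]
    rw [e, h.cell_comp (by omega), h.cell_eps_left hi, h.cell_eq_transfer_zero_right h0 hj,
      h.transfer_comp (i := i) (j := 0) (l := j) hi (by omega) hj (by omega)
        (by omega) (by omega), h.transfer_eps_left (by omega) hi0 hi]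
  rcases Nat.eq_zero_or_pos j with rfl | h0
  -- The detour into `a 0` must pass through some `l < 3`, where `ε_{0l} ε_{l0}` is the identity and
  -- not just an idempotent.
  · obtain ⟨l, hl0, hl, hil⟩ : ∃ l, 0 < l ∧ l < 3 ∧ i ≠ l := by
      by_cases hi1 : i = 1
      · exact ⟨2, by omega, by omega, by omega⟩
      · exact ⟨1, by omega, by omega, hi1⟩
    have e : f = Φ.ideals.eps 3 0 l ∘ₗ (Φ.ideals.eps 3 l 0 ∘ₗ f) := by
      rw [h.ideals.eps_zero_comp_eps_comp hl]
    rw [e, h.cell_comp (by omega), h.cell_eps_left (by omega), main i hi l (by omega) hl0 hil,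
      h.transfer_comp (i := i) (j := l) (l := 0) hi (by omega) (by omega) hil
        (by omega) (by omega), h.transfer_eps_left (by omega) hl0 (by omega)]
  · exact main i hi j hj h0 hij f

theorem IsStableFrame.etaMatrix_apply (φ : Module.End Rᵐᵒᵖ R) {i : ℕ} (hi : i < 3 + k)
    (v : (Φ.map ι).a i) :
    etaMatrix 3 k (principalRightIdeals R) Φ ι φ v = ∑ j ∈ Finset.range (3 + k),
      (cell ι (frameComponent Φ.ideals.a (3 + k) φ j i) v : M) := by
  simp only [etaMatrix, etaCoefficient_eq, LinearMap.sum_apply, LinearMap.comp_apply,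
    Submodule.subtype_apply]
  rw [Finset.sum_eq_single i]
  · refine Finset.sum_congr rfl fun j _ => ?_
    rw [(h.map ι).frameProj_apply hi]
    rfl
  · intro l hl hli
    refine Finset.sum_eq_zero fun j _ => ?_
    rw [(h.map ι).frameProj_apply_ne (Finset.mem_range.1 hl) hi hli]
    simp only [map_zero, Submodule.coe_zero]
  · exact fun hi' => absurd (Finset.mem_range.2 hi) hi'

theorem IsStableFrame.etaMatrix_one :
    etaMatrix 3 k (principalRightIdeals R) Φ ι 1 = 1 := by
  refine (h.map ι).end_ext fun i hi v => ?_
  rw [h.etaMatrix_apply 1 hi, Finset.sum_eq_single i]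
  · rw [h.ideals.frameComponent_one_self hi, h.cell_id hi]
    rfl
  · intro j hj hji
    rw [h.ideals.frameComponent_one_ne (Finset.mem_range.1 hj) hi hji, h.cell_zero]
    rfl
  · exact fun hi' => absurd (Finset.mem_range.2 hi) hi'

theorem IsStableFrame.etaMatrix_add (φ ψ : Module.End Rᵐᵒᵖ R) :
    etaMatrix 3 k (principalRightIdeals R) Φ ι (φ + ψ) =
      etaMatrix 3 k (principalRightIdeals R) Φ ι φ +
        etaMatrix 3 k (principalRightIdeals R) Φ ι ψ := by
  refine (h.map ι).end_ext fun i hi v => ?_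
  rw [LinearMap.add_apply, h.etaMatrix_apply _ hi, h.etaMatrix_apply _ hi,
    h.etaMatrix_apply _ hi, ← Finset.sum_add_distrib]
  refine Finset.sum_congr rfl fun j _ => ?_
  rw [frameComponent_add, h.cell_add]
  rfl

theorem IsStableFrame.etaMatrix_mul (φ ψ : Module.End Rᵐᵒᵖ R) :
    etaMatrix 3 k (principalRightIdeals R) Φ ι (φ * ψ) =
      etaMatrix 3 k (principalRightIdeals R) Φ ι φ *
        etaMatrix 3 k (principalRightIdeals R) Φ ι ψ := by
  refine (h.map ι).end_ext fun i hi v => ?_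
  rw [Module.End.mul_apply, h.etaMatrix_apply _ hi, h.etaMatrix_apply _ hi, map_sum]
  have e : ∀ j ∈ Finset.range (3 + k), etaMatrix 3 k (principalRightIdeals R) Φ ι φ
      (cell ι (frameComponent Φ.ideals.a (3 + k) ψ j i) v) = ∑ l ∈ Finset.range (3 + k),
        (cell ι (frameComponent Φ.ideals.a (3 + k) φ l j)
          (cell ι (frameComponent Φ.ideals.a (3 + k) ψ j i) v) : M) :=
    fun j hj => h.etaMatrix_apply φ (Finset.mem_range.1 hj) _
  rw [Finset.sum_congr rfl e, Finset.sum_comm]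
  refine Finset.sum_congr rfl fun l _ => ?_
  rw [h.ideals.frameComponent_mul, h.cell_sum, LinearMap.sum_apply, Submodule.coe_sum]
  refine Finset.sum_congr rfl fun j hj => ?_
  rw [h.cell_comp (Finset.mem_range.1 hj)]
  rfl

theorem IsStableFrame.etaMatrix_eq_zero (hι : Function.Injective ι) {φ : Module.End Rᵐᵒᵖ R}
    (hφ : etaMatrix 3 k (principalRightIdeals R) Φ ι φ = 0) : φ = 0 := by
  refine h.ideals.eq_zero_of_frameComponent fun i hi j hj => h.cell_injective hι hi hj ?_
  ext v : 1
  have hv := h.etaMatrix_apply φ hi v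
  rw [hφ, LinearMap.zero_apply] at hv
  have hp := congrArg (frameProj (Φ.map ι).a (3 + k) j) hv
  rw [map_zero, map_sum, Finset.sum_eq_single j, (h.map ι).frameProj_apply hj] at hp
  · exact hp.symm
  · intro l hl hlj
    exact (h.map ι).frameProj_apply_ne hj (Finset.mem_range.1 hl) hlj.symm _
  · exact fun hj' => absurd (Finset.mem_range.2 hj) hj'

end Cell

end FrameData

/-! ### Adjoints -/

section StarAdjoint

variable {R : Type*} [Ring R] [StarRing R] {A B C : Submodule Rᵐᵒᵖ R}

/-- `f` and `g` are adjoint to each other with respect to `⟨x, y⟩ = x^* y`. -/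
def IsStarAdjoint (f : A →ₗ[Rᵐᵒᵖ] B) (g : B →ₗ[Rᵐᵒᵖ] A) : Prop :=
  ∀ (x : A) (y : B), star (f x : R) * y = star (x : R) * g y

theorem IsStarAdjoint.comp {f : A →ₗ[Rᵐᵒᵖ] B} {f' : B →ₗ[Rᵐᵒᵖ] A} {g : B →ₗ[Rᵐᵒᵖ] C}
    {g' : C →ₗ[Rᵐᵒᵖ] B} (hg : IsStarAdjoint g g') (hf : IsStarAdjoint f f') :
    IsStarAdjoint (g ∘ₗ f) (f' ∘ₗ g') := by
  intro x y
  rw [LinearMap.comp_apply, hg, hf]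
  rfl

variable [IsStarRegularRing R]

/-- Testing `g y - g' y` against itself gives `d^* d = 0`, and properness applies to `d^*`. -/
theorem IsStarAdjoint.unique {f : A →ₗ[Rᵐᵒᵖ] B} {g g' : B →ₗ[Rᵐᵒᵖ] A}
    (hg : IsStarAdjoint f g) (hg' : IsStarAdjoint f g') : g = g' := by
  ext y : 1
  rw [← sub_eq_zero]
  refine Subtype.ext (star_eq_zero.1 (IsStarRegularRing.proper _ ?_))
  rw [star_star]
  have := (hg (g y - g' y) y).symm.trans (hg' (g y - g' y) y)
  rw [← sub_eq_zero, ← mul_sub] at this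
  exact this

/-- With `p` the projection generating `A`, `f` is left multiplication by `f p`, so its adjoint is
left multiplication by `(f p)^*`. This lands in `A` because `(f p) p = f p`. -/
theorem exists_isStarAdjoint (hA : A.IsPrincipal) (hB : B.IsPrincipal) (f : A →ₗ[Rᵐᵒᵖ] B) :
    ∃ g : B →ₗ[Rᵐᵒᵖ] A, IsStarAdjoint f g := by
  obtain ⟨p, hps, hpp, hp⟩ := exists_isProjectionOf hA
  obtain ⟨q, hqs, hqq, hq⟩ := exists_isProjectionOf hB
  set p' : A := ⟨p, (hp p).2 hpp⟩
  have hfx : ∀ x : A, (f x : R) = f p' * x := by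
    intro x
    have hx : x = MulOpposite.op (x : R) • p' := Subtype.ext ((hp x).1 x.2).symm
    conv_lhs => rw [hx, map_smul]
    rfl
  have hfp : (f p' : R) * p = f p' := (hfx p').symm
  have hA' : ∀ y : R, star (f p' : R) * y ∈ A := by
    intro y
    rw [hp, ← mul_assoc]
    conv_lhs => rw [← hps, ← star_mul, hfp]
  refine ⟨{ toFun := fun y => ⟨star (f p' : R) * y, hA' y⟩
            map_add' := fun y z => Subtype.ext (mul_add _ _ _)
            map_smul' := fun c y => Subtype.ext (mul_smul_comm c _ _) }, ?_⟩
  intro x y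
  rw [hfx, star_mul, mul_assoc]
  rfl

end StarAdjoint

/-! ### Additivity of hermitian forms -/

theorem HermitianForm.zero_left {D : Type*} [DivisionRing D] [StarRing D] {V : Type*}
    [AddCommGroup V] [Module Dᵐᵒᵖ V] (B : HermitianForm D V) (w : V) : B.form 0 w = 0 := by
  simpa using B.add_left 0 0 w

theorem HermitianForm.zero_right {D : Type*} [DivisionRing D] [StarRing D] {V : Type*}
    [AddCommGroup V] [Module Dᵐᵒᵖ V] (B : HermitianForm D V) (w : V) : B.form w 0 = 0 := by
  simpa using B.add_right w 0 0

theorem HermitianForm.sum_left {D : Type*} [DivisionRing D] [StarRing D] {V : Type*}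
    [AddCommGroup V] [Module Dᵐᵒᵖ V] (B : HermitianForm D V) {κ : Type*} (s : Finset κ)
    (v : κ → V) (w : V) : B.form (∑ l ∈ s, v l) w = ∑ l ∈ s, B.form (v l) w :=
  map_sum (AddMonoidHom.mk' (fun v => B.form v w) fun u v => B.add_left u v w) v s

theorem HermitianForm.sum_right {D : Type*} [DivisionRing D] [StarRing D] {V : Type*}
    [AddCommGroup V] [Module Dᵐᵒᵖ V] (B : HermitianForm D V) {κ : Type*} (s : Finset κ)
    (v : κ → V) (w : V) : B.form w (∑ l ∈ s, v l) = ∑ l ∈ s, B.form w (v l) :=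
  map_sum (AddMonoidHom.mk' (fun v => B.form w v) fun u v => B.add_right w u v) v s

theorem HermitianForm.sub_right {D : Type*} [DivisionRing D] [StarRing D] {V : Type*}
    [AddCommGroup V] [Module Dᵐᵒᵖ V] (B : HermitianForm D V) (u v w : V) :
    B.form u (v - w) = B.form u v - B.form u w :=
  map_sub (AddMonoidHom.mk' (fun v => B.form u v) fun v w => B.add_right u v w) v w

theorem HermitianForm.sub_left {D : Type*} [DivisionRing D] [StarRing D] {V : Type*}
    [AddCommGroup V] [Module Dᵐᵒᵖ V] (B : HermitianForm D V) (u v w : V) :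
    B.form (u - v) w = B.form u w - B.form v w :=
  map_sub (AddMonoidHom.mk' (fun v => B.form v w) fun u v => B.add_left u v w) u v

/-! ### Adjoints in the representation space -/

section Adjoint

variable {R : Type*} [Ring R] [StarRing R] [IsStarRegularRing R]
  {D : Type*} [DivisionRing D] [StarRing D] {V : Type*} [AddCommGroup V] [Module Dᵐᵒᵖ V]
  {B : HermitianForm D V}

/-- The homomorphism of bounded lattices underlying a representation. -/
abbrev MOLRepresentation.hom {L : Type*} [Lattice L] [BoundedOrder L] [Compl L]
    (ι : MOLRepresentation L B) : BoundedLatticeHom L (Submodule Dᵐᵒᵖ V) :=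
  ι.toBoundedLatticeHom

theorem MOLRepresentation.form_eq_zero {L : Type*} [Lattice L] [BoundedOrder L] [Compl L]
    (ι : MOLRepresentation L B) {I J : L} (h : J ≤ Iᶜ) {x y : V} (hx : x ∈ ι.hom I)
    (hy : y ∈ ι.hom J) : B.form x y = 0 := by
  have hy' : y ∈ ι.hom Iᶜ := OrderHomClass.mono ι.hom h hy
  have e : ι.hom Iᶜ = B.perp (ι.hom I) := ι.map_compl' I
  rw [e] at hy'
  exact hy' x hx

variable {ι : MOLRepresentation (principalRightIdeals R) B}

/-- As `I ⊥ J`, the product `(a - f a)^* (b + g b)` reduces to `a^* g b - (f a)^* b = 0`, so the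
graphs of `f` and `-g` are orthogonal and so are their images. The sign stays inside `graphMap`
until additivity of `cell` extracts it. -/
theorem form_graphMap {I J : principalRightIdeals R} (hIJ : J ≤ Iᶜ)
    {f : I.1 →ₗ[Rᵐᵒᵖ] J.1} {g : J.1 →ₗ[Rᵐᵒᵖ] I.1} (hfg : IsStarAdjoint f g)
    (x : ι.hom I) (y : ι.hom J) :
    B.form (graphMap ι.hom f x) y = -B.form x (graphMap ι.hom (-g) y) := by
  have hJI : I ≤ Jᶜ := by
    rw [← IsModularOrtholattice.compl_compl' I]
    exact IsModularOrtholattice.compl_antitone' _ _ hIJ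
  have hd : Disjoint I J :=
    (IsModularOrtholattice.isCompl_compl' I).disjoint.mono_right hIJ
  have hle : principalGraph (-g) ≤ (principalGraph f)ᶜ := by
    intro m hm m' hm'
    obtain ⟨b, rfl⟩ := mem_negGraph.1 hm
    obtain ⟨a, rfl⟩ := mem_negGraph.1 hm'
    have h1 : star (a : R) * b = 0 := hIJ b.2 a a.2
    have h2 : star (f a : R) * g b = 0 := hJI (g b).2 (f a) (f a).2
    rw [star_sub, LinearMap.neg_apply, Submodule.coe_neg, sub_neg_eq_add, mul_add, sub_mul,
      sub_mul, h1, h2, hfg]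
    abel
  have hx := sub_mem_negGraph (graphMap ι.hom f) x
  have hy := sub_mem_negGraph (graphMap ι.hom (-g)) y
  rw [negGraph_graphMap hd] at hx
  rw [negGraph_graphMap hd.symm] at hy
  have h0 := ι.form_eq_zero hle hx hy
  have h1 : B.form (x : V) y = 0 := ι.form_eq_zero hIJ x.2 y.2
  have h2 : B.form (graphMap ι.hom f x : V) (graphMap ι.hom (-g) y) = 0 :=
    ι.form_eq_zero hJI (graphMap ι.hom f x).2 (graphMap ι.hom (-g) y).2
  rw [B.sub_left, B.sub_right, B.sub_right, h1, h2, zero_sub, sub_zero] at h0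
  rw [eq_neg_iff_add_eq_zero, ← neg_eq_zero, ← h0]
  abel

namespace FrameData

variable {Φ : FrameData (principalRightIdeals R)} {k : ℕ}
  (h : Φ.IsStableOrthogonalFrame 3 k)
include h

omit [IsStarRegularRing R] in
omit [StarRing R] [Ring R] h in
theorem IsStableOrthogonalFrame.le_compl {L : Type*} [Lattice L] [BoundedOrder L] [Compl L]
    {n k : ℕ} {Φ : FrameData L} (h : Φ.IsStableOrthogonalFrame n k) {i j : ℕ} (hi : i < n + k)
    (hj : j < n + k) (hij : i ≠ j) : Φ.a j ≤ (Φ.a i)ᶜ := by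
  rw [h.orthogonal i hi]
  exact Finset.le_sup (f := Φ.a) (Finset.mem_erase.2 ⟨hij.symm, Finset.mem_range.2 hj⟩)

theorem IsStableOrthogonalFrame.form_cell_of_ne {i j : ℕ} (hi : i < 3 + k) (hj : j < 3 + k)
    (hij : i ≠ j) {f : Φ.ideals.a i →ₗ[Rᵐᵒᵖ] Φ.ideals.a j}
    {g : Φ.ideals.a j →ₗ[Rᵐᵒᵖ] Φ.ideals.a i} (hfg : IsStarAdjoint f g)
    (x : (Φ.map ι.hom).a i) (y : (Φ.map ι.hom).a j) :
    B.form (cell ι.hom f x) y = B.form x (cell ι.hom g y) := by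
  have h1 := form_graphMap (ι := ι) (h.le_compl hi hj hij) hfg x y
  change B.form (transfer ι.hom f x) y = -B.form x (transfer ι.hom (-g) y) at h1
  rw [← h.cell_eq_transfer hi hj hij, ← h.cell_eq_transfer hj hi hij.symm, h.cell_neg,
    LinearMap.neg_apply, Submodule.coe_neg] at h1
  rw [h1, ← zero_sub (cell ι.hom g y : V), B.sub_right, B.zero_right, zero_sub, neg_neg]

theorem IsStableOrthogonalFrame.form_cell {i j : ℕ} (hi : i < 3 + k) (hj : j < 3 + k)
    {f : Φ.ideals.a i →ₗ[Rᵐᵒᵖ] Φ.ideals.a j}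
    {g : Φ.ideals.a j →ₗ[Rᵐᵒᵖ] Φ.ideals.a i} (hfg : IsStarAdjoint f g)
    (x : (Φ.map ι.hom).a i) (y : (Φ.map ι.hom).a j) :
    B.form (cell ι.hom f x) y = B.form x (cell ι.hom g y) := by
  by_cases hij : i = j
  · subst hij
    -- A diagonal component has no graph to compare, so it is factored through a different index; by
    -- uniqueness its adjoint is the composite of the adjoints of the factors.
    obtain ⟨l, hl, hil, u, w, rfl⟩ : ∃ l < 3 + k, i ≠ l ∧
        ∃ (u : Φ.ideals.a l →ₗ[Rᵐᵒᵖ] Φ.ideals.a i) (w : Φ.ideals.a i →ₗ[Rᵐᵒᵖ] Φ.ideals.a l),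
          f = u ∘ₗ w := by
      rcases Nat.eq_zero_or_pos i with rfl | h0
      · refine ⟨1, by omega, by omega, f ∘ₗ Φ.ideals.eps 3 0 1, Φ.ideals.eps 3 1 0, ?_⟩
        rw [LinearMap.comp_assoc, h.ideals.eps_zero_comp_eps (by omega), LinearMap.comp_id]
      · refine ⟨0, by omega, h0.ne', f ∘ₗ Φ.ideals.eps 3 i 0, Φ.ideals.eps 3 0 i, ?_⟩
        rw [LinearMap.comp_assoc, h.ideals.eps_comp_eps (by omega) hi, LinearMap.comp_id]
    obtain ⟨u', hu⟩ : ∃ u' : Φ.ideals.a i →ₗ[Rᵐᵒᵖ] Φ.ideals.a l, IsStarAdjoint u u' :=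
      exists_isStarAdjoint (Φ.a l).2 (Φ.a i).2 u
    obtain ⟨w', hw⟩ : ∃ w' : Φ.ideals.a l →ₗ[Rᵐᵒᵖ] Φ.ideals.a i, IsStarAdjoint w w' :=
      exists_isStarAdjoint (Φ.a i).2 (Φ.a l).2 w
    obtain rfl := hfg.unique (hu.comp hw)
    rw [h.cell_comp hl, h.cell_comp hl, LinearMap.comp_apply, LinearMap.comp_apply,
      h.form_cell_of_ne hl hi hil.symm hu, h.form_cell_of_ne hi hl hil hw]
  · exact h.form_cell_of_ne hi hj hij hfg x y

/-- Since `a_i^⊥` is the join of the other components, the frame projections are orthogonal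
projections. -/
theorem IsStableOrthogonalFrame.star_mul_frameProj {i : ℕ} (hi : i < 3 + k)
    (x : Φ.ideals.a i) (m : R) :
    star (x : R) * frameProj Φ.ideals.a (3 + k) i m = star (x : R) * m := by
  have hm := h.ideals.sub_frameProj_mem hi m
  have e : ((Finset.range (3 + k)).erase i).sup Φ.ideals.a = ((Φ.a i)ᶜ).1 := by
    rw [h.orthogonal i hi]
    exact (map_finset_sup (principalRightIdealsIncl R) _ _).symm
  rw [e] at hm
  have := hm x x.2
  rw [mul_sub, sub_eq_zero] at this
  exact this.symm

theorem IsStableOrthogonalFrame.isStarAdjoint_frameComponent {i j : ℕ} (hi : i < 3 + k)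
    (hj : j < 3 + k) (r : R) :
    IsStarAdjoint
      (frameComponent Φ.ideals.a (3 + k) (Module.toModuleEnd Rᵐᵒᵖ (S := R) R r) j i)
      (frameComponent Φ.ideals.a (3 + k) (Module.toModuleEnd Rᵐᵒᵖ (S := R) R (star r)) i j) := by
  intro x y
  change star (frameProj Φ.ideals.a (3 + k) j (r * x) : R) * y =
    star (x : R) * frameProj Φ.ideals.a (3 + k) i (star r * y)
  rw [h.star_mul_frameProj hi, ← star_star (y : R), ← star_mul, h.star_mul_frameProj hj,
    star_mul, star_mul, star_star, mul_assoc]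

theorem IsStableOrthogonalFrame.form_frame_ne {i j : ℕ} (hi : i < 3 + k) (hj : j < 3 + k)
    (hij : i ≠ j) (x : (Φ.map ι.hom).a i) (y : (Φ.map ι.hom).a j) : B.form (x : V) y = 0 :=
  ι.form_eq_zero (h.le_compl hi hj hij) x.2 y.2

/-- By biadditivity both vectors may be taken in single components `i` and `j`; orthogonality then
leaves only the matrix entries `(j, i)` of `r` and `(i, j)` of `r^*`. -/
theorem IsStableOrthogonalFrame.isAdjoint_etaMatrix (r : R) :
    B.IsAdjoint
      (etaMatrix 3 k (principalRightIdeals R) Φ ι.hom (Module.toModuleEnd Rᵐᵒᵖ (S := R) R r))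
      (etaMatrix 3 k (principalRightIdeals R) Φ ι.hom
        (Module.toModuleEnd Rᵐᵒᵖ (S := R) R (star r))) := by
  have hs := h.map ι.hom
  intro v w
  refine hs.induction (p := fun v => B.form (etaMatrix 3 k _ Φ ι.hom _ v) w =
    B.form v (etaMatrix 3 k _ Φ ι.hom _ w)) ?_ ?_ ?_ v
  · intro i hi x
    refine hs.induction (p := fun w => B.form (etaMatrix 3 k _ Φ ι.hom _ x) w =
      B.form x (etaMatrix 3 k _ Φ ι.hom _ w)) ?_ ?_ ?_ w
    · intro j hj y
      rw [h.etaMatrix_apply _ hi, h.etaMatrix_apply _ hj, B.sum_left, B.sum_right,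
        Finset.sum_eq_single j, Finset.sum_eq_single i]
      · exact h.form_cell hi hj (h.isStarAdjoint_frameComponent hi hj r) x y
      · intro l hl hli
        exact h.form_frame_ne hi (Finset.mem_range.1 hl) hli.symm _ _
      · exact fun hi' => absurd (Finset.mem_range.2 hi) hi'
      · intro l hl hlj
        exact h.form_frame_ne (Finset.mem_range.1 hl) hj hlj _ _
      · exact fun hj' => absurd (Finset.mem_range.2 hj) hj'
    · rw [map_zero, B.zero_right, B.zero_right]
    · intro w w' hw hw'
      rw [map_add, B.add_right, B.add_right, hw, hw']
  · rw [map_zero, B.zero_left, B.zero_left]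
  · intro v v' hv hv'
    rw [map_add, B.add_left, B.add_left, hv, hv']

end FrameData

/-- Nondegeneracy comes from the representation itself: the radical is `ι(⊤)^⊥ = ι(⊤ᶜ) = ι(⊥) = 0`.
Anisotropy is not assumed. -/
theorem MOLRepresentation.eq_zero_of_form {L : Type*} [Lattice L] [BoundedOrder L] [Compl L]
    [IsModularOrtholattice L] (ι : MOLRepresentation L B) {w : V} (hw : ∀ v, B.form v w = 0) :
    w = 0 := by
  have hbot : (⊤ : L)ᶜ = ⊥ := by
    have := (IsModularOrtholattice.isCompl_compl' (⊤ : L)).inf_eq_bot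
    rwa [top_inf_eq] at this
  have e : ι.hom (⊤ : L)ᶜ = B.perp (ι.hom ⊤) := ι.map_compl' ⊤
  rw [hbot, map_bot] at e
  have hm : w ∈ B.perp (ι.hom ⊤) := fun v _ => hw v
  rw [← e] at hm
  exact hm

theorem HermitianForm.IsAdjoint.unique {L : Type*} [Lattice L] [BoundedOrder L] [Compl L]
    [IsModularOrtholattice L] (ι : MOLRepresentation L B) {f g g' : Module.End Dᵐᵒᵖ V}
    (hg : B.IsAdjoint f g) (hg' : B.IsAdjoint f g') : g = g' := by
  ext w
  rw [← sub_eq_zero]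
  refine ι.eq_zero_of_form fun v => ?_
  rw [B.sub_right, ← hg, ← hg', sub_self]

end Adjoint

theorem mainTheorem5 {R : Type*} [Ring R] [StarRing R] [IsStarRegularRing R]
    {D : Type*} [DivisionRing D] [StarRing D]
    {V : Type*} [AddCommGroup V] [Module Dᵐᵒᵖ V] (B : HermitianForm D V)
    (k : ℕ) (Φ : FrameData (principalRightIdeals R)) (hΦ : Φ.IsStableOrthogonalFrame 3 k)
    (ι : MOLRepresentation (principalRightIdeals R) B) (hι : Function.Injective ι.toFun) :
    ∃ ρ : R →+* Module.End Dᵐᵒᵖ V,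
      (∀ r, ρ r = inducedRho 3 k Φ ι r) ∧
      Function.Injective ρ ∧
      ∀ (r : R) (g : Module.End Dᵐᵒᵖ V), B.IsAdjoint (ρ r) g ↔ g = ρ (star r) := by
  let lmul : R →+* Module.End Rᵐᵒᵖ R := Module.toModuleEnd Rᵐᵒᵖ (S := R) R
  let ρ : R →+* Module.End Dᵐᵒᵖ V := RingHom.mk'
    { toFun := fun r => etaMatrix 3 k (principalRightIdeals R) Φ ι.hom (lmul r)
      map_one' := by rw [map_one, hΦ.etaMatrix_one]
      map_mul' := fun r s => by rw [map_mul, hΦ.etaMatrix_mul] }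
    fun r s => by
      change etaMatrix 3 k _ Φ ι.hom (lmul (r + s)) = _
      rw [map_add, hΦ.etaMatrix_add]
      rfl
  refine ⟨ρ, fun r => rfl, ?_, ?_⟩
  · rw [injective_iff_map_eq_zero]
    intro r hr
    have h0 : lmul r = 0 := hΦ.etaMatrix_eq_zero hι hr
    -- Left multiplication is faithful because `R` is unital.
    have h1 : r * 1 = 0 := LinearMap.congr_fun h0 (1 : R)
    rwa [mul_one] at h1
  · intro r g
    have hadj : B.IsAdjoint (ρ r) (ρ (star r)) := hΦ.isAdjoint_etaMatrix r
    constructor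
    · exact fun hg => hg.unique ι hadj
    · rintro rfl
      exact hadj
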